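/- Label the vertices of a nondegenerate tetrahedron in $\mathbb{R}^3$ by $V_1,V_2,V_3,V_4$ and let $d_{ij}=|V_iV_j|$. A tetrahedron belongs to Goldberg's first family, with parameters $a,b,c$, if $$d_{12}=d_{23}=d_{34}=b,\quad d_{13}=d_{24}=c,\quad d_{14}=a,\qquad \tfrac{a^2}{3}+b^2=c^2 ,$$ and to Goldberg's second family, with parameters $a,b,c,d$, if $$d_{12}=d_{23}=b,\quad d_{13}=c,\quad d_{14}=\tfrac a2,\quad d_{24}=d_{34}=d,\qquad \tfrac{a^2}{12}+d^2=b^2,\quad \tfrac{a^2}{3}+b^2=c^2 .$$ A face-to-face tiling by a tetrahedron $T$ is a set of congruent copies of $T$ (mirror images allowed) that covers $\mathbb{R}^3$, in which distinct tiles have disjoint interiors and any two tiles meet in a common (possibly empty) face. A set of tiles is orientation-preserving if any two of its members are equivalent under an orientation-preserving isometry of $\mathbb{R}^3$. **Proposition 3.2.** For all real $a,b$ with $0<a<3b$ both families have a member with these values of $a,b$. Moreover: 1. Every tetrahedron $T$ of either family admits a face-to-face tiling $\mathcal T$ of $\mathbb{R}^3$. It can be chosen so that there is a tiling of $\mathbb{R}^3$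 by right equilateral triangular prisms, infinitely long in both directions, with the following properties: every tile of $\mathcal T$ lies in one of the prisms; each prism is the union of the tiles that it contains, and these tiles form an orientation-preserving set; and if $\sigma$ is the reflection in the plane of a lateral face of a prism $P$ of the tiling, then $\sigma(P)$ is again a prism of the tiling, and the tiles in $\sigma(P)$ are exactly the images under $\sigma$ of the tiles in $P$. 2. In general reflected copies are needed: if $T$ is in the first family with $a\ne b$ and $a\ne c$, or in the second family with $a\ne 2d$, then no face-to-face tiling of $\mathbb{R}^3$ by $T$ is orientation-preserving. -/

import Mathlib

open Set

/-- Euclidean three-space `ℝ³`. -/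
abbrev E3 : Type := EuclideanSpace ℝ (Fin 3)

/-- A (nondegenerate, vertex-labelled) tetrahedron in `ℝ³`.  The vertices `V₁, V₂, V₃, V₄` are
`T.points 0, T.points 1, T.points 2, T.points 3`. -/
abbrev Tetrahedron : Type := Affine.Simplex ℝ E3 3

namespace Tetrahedron

/-- The solid tetrahedron, as a closed subset of `ℝ³`. -/
def body (T : Tetrahedron) : Set E3 := convexHull ℝ (range T.points)

/-- The edge length `d_{ij}` (with indices starting at `0`). -/
noncomputable def len (T : Tetrahedron) (i j : Fin 4) : ℝ := dist (T.points i) (T.points j)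

/-- `T` is the member of the first Goldberg family with edge lengths
`d₁₂ = d₂₃ = d₃₄ = b`, `d₁₃ = d₂₄ = c`, `d₁₄ = a`, where `a² / 3 + b² = c²`. -/
structure IsGoldbergFirst (a b c : ℝ) (T : Tetrahedron) : Prop where
  rel : a ^ 2 / 3 + b ^ 2 = c ^ 2
  len12 : T.len 0 1 = b
  len13 : T.len 0 2 = c
  len14 : T.len 0 3 = a
  len23 : T.len 1 2 = b
  len24 : T.len 1 3 = c
  len34 : T.len 2 3 = b

/-- `T` is the member of the second Goldberg family with edge lengths
`d₁₂ = d₂₃ = b`, `d₁₃ = c`, `d₁₄ = a / 2`, `d₂₄ = d₃₄ = d`, where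
`a² / 12 + d² = b²` and `a² / 3 + b² = c²`. -/
structure IsGoldbergSecond (a b c d : ℝ) (T : Tetrahedron) : Prop where
  rel₁ : a ^ 2 / 12 + d ^ 2 = b ^ 2
  rel₂ : a ^ 2 / 3 + b ^ 2 = c ^ 2
  len12 : T.len 0 1 = b
  len13 : T.len 0 2 = c
  len14 : T.len 0 3 = a / 2
  len23 : T.len 1 2 = b
  len24 : T.len 1 3 = d
  len34 : T.len 2 3 = d

end Tetrahedron

/-- An isometry of `ℝ³` is orientation-preserving if its linear part has positive determinant. -/
def IsDirectIsometry (φ : E3 ≃ᵃⁱ[ℝ] E3) : Prop :=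
  0 < LinearMap.det (φ.linearIsometryEquiv.toLinearEquiv : E3 →ₗ[ℝ] E3)

/-- Two subsets of `ℝ³` are congruent, mirror images being allowed. -/
def CongruentSets (K L : Set E3) : Prop := ∃ φ : E3 ≃ᵃⁱ[ℝ] E3, φ '' K = L

/-- Two subsets of `ℝ³` are equivalent under an orientation-preserving isometry. -/
def DirectlyCongruent (K L : Set E3) : Prop :=
  ∃ φ : E3 ≃ᵃⁱ[ℝ] E3, IsDirectIsometry φ ∧ φ '' K = L

/-- `F` is a face of the convex set `K`: a convex subset containing both end points of every
segment of `K` that meets it in an interior point of the segment.  For a polytope these are the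
usual faces (vertices, edges, facets, ...), together with `∅` and the polytope itself. -/
def IsFaceOf (F K : Set E3) : Prop := Convex ℝ F ∧ IsExtreme ℝ K F

/-- `𝒯` is a face-to-face tiling of `ℝ³` by congruent copies (possibly reflected) of `T`: the
tiles cover space, distinct tiles have disjoint interiors, and any two tiles meet in a common
(possibly empty) face. -/
structure IsFaceToFaceTiling (T : Tetrahedron) (𝒯 : Set (Set E3)) : Prop where
  congruent : ∀ K ∈ 𝒯, CongruentSets T.body K
  cover : ⋃₀ 𝒯 = univ
  disjoint_interior : ∀ K ∈ 𝒯, ∀ L ∈ 𝒯, K ≠ L → Disjoint (interior K) (interior L)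
  face_to_face : ∀ K ∈ 𝒯, ∀ L ∈ 𝒯, IsFaceOf (K ∩ L) K ∧ IsFaceOf (K ∩ L) L

/-- A tiling is orientation-preserving if any two tiles are equivalent under an
orientation-preserving isometry of `ℝ³`. -/
def IsOrientationPreserving (𝒯 : Set (Set E3)) : Prop :=
  ∀ K ∈ 𝒯, ∀ L ∈ 𝒯, DirectlyCongruent K L

/-- The direction of the line orthogonal to the plane of the triangle `B`. -/
noncomputable def prismAxis (B : Affine.Triangle ℝ E3) : Submodule ℝ E3 :=
  (vectorSpan ℝ (range B.points))ᗮ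

/-- The right prism over the triangle `B`, infinitely long in both directions. -/
def prism (B : Affine.Triangle ℝ E3) : Set E3 :=
  {x | ∃ y ∈ convexHull ℝ (range B.points), ∃ v ∈ prismAxis B, x = y + v}

/-- The plane of the lateral face of `prism B` over the edge of `B` opposite to its vertex `i`. -/
noncomputable def prismWall (B : Affine.Triangle ℝ E3) (i : Fin 3) : AffineSubspace ℝ E3 :=
  AffineSubspace.mk' (B.points (i + 1))
    (Submodule.span ℝ {B.points (i + 2) - B.points (i + 1)} ⊔ prismAxis B)

noncomputable instance (B : Affine.Triangle ℝ E3) (i : Fin 3) : Nonempty (prismWall B i) :=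
  inferInstanceAs (Nonempty (AffineSubspace.mk' _ _))

/-- The orthogonal reflection of `ℝ³` in the plane of a lateral face of `prism B`. -/
noncomputable def prismMirror (B : Affine.Triangle ℝ E3) (i : Fin 3) : E3 ≃ᵃⁱ[ℝ] E3 :=
  EuclideanGeometry.reflection (prismWall B i)

/-- The members of `𝒯` that lie in `P`. -/
def tilesIn (𝒯 : Set (Set E3)) (P : Set E3) : Set (Set E3) := {K ∈ 𝒯 | K ⊆ P}

/-- `𝒯` arises by cutting the infinite equilateral triangular prisms of a tiling of `ℝ³` by such
prisms into pairwise directly congruent pieces, in such a way that the mirror image of a prism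
of the tiling in any of its lateral faces is again a prism of the tiling, cut in the
mirror-image way. -/
def IsAlternatingPrismDissection (𝒯 : Set (Set E3)) : Prop :=
  ∃ 𝒬 : Set (Set E3),
    ⋃₀ 𝒬 = univ ∧
    (∀ P ∈ 𝒬, ∀ Q ∈ 𝒬, P ≠ Q → Disjoint (interior P) (interior Q)) ∧
    (∀ K ∈ 𝒯, ∃ P ∈ 𝒬, K ⊆ P) ∧
    ∀ P ∈ 𝒬,
      ⋃₀ tilesIn 𝒯 P = P ∧
      IsOrientationPreserving (tilesIn 𝒯 P) ∧
      ∃ B : Affine.Triangle ℝ E3, B.Equilateral ∧ P = prism B ∧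
        ∀ i : Fin 3,
          prismMirror B i '' P ∈ 𝒬 ∧
          tilesIn 𝒯 (prismMirror B i '' P) =
            (fun K => prismMirror B i '' K) '' tilesIn 𝒯 P

/-!
In a tetrahedron of the first family the edge vectors of the path `V₁V₂V₃V₄` have equal lengths and
equal mutual inner products, so in the coordinates given by these vectors the permutations of the
coordinates and the integral translations generate a group of isometries. The tetrahedron is the
chamber `1 ≥ x₀ ≥ x₁ ≥ x₂ ≥ 0` of that group, and its images tile space. The columns
`x₀ ≥ x₁ ≥ x₂ ≥ x₀ - 1` are prisms over equilateral triangles; the tiles of a column are the images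
of the chamber under the powers of a screw motion, hence directly congruent, and the reflections in
the lateral planes lie in the group. A half-turn cuts the chamber into two tetrahedra of the second
family, all of which arise in this way.

For the negative part, the tile adjacent to a given one along a suitable facet shares three vertices
with it, and the edge lengths leave only one labelling of these up to a direct symmetry. If the two
tiles were directly congruent, they would therefore coincide.
-/

section ConvexGeometry

variable {E F : Type*} [AddCommGroup E] [Module ℝ E] [AddCommGroup F] [Module ℝ F]

theorem isExtreme_image {A B : Set E} (h : IsExtreme ℝ A B) {f : E →ᵃ[ℝ] F}
    (hf : Function.Injective f) : IsExtreme ℝ (f '' A) (f '' B) := by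
  refine ⟨image_mono h.subset, ?_⟩
  rintro _ ⟨p, hp, rfl⟩ _ ⟨q, hq, rfl⟩ _ ⟨z, hz, rfl⟩ hseg
  rw [← image_openSegment, hf.mem_set_image] at hseg
  exact mem_image_of_mem f (h.left_mem_of_mem_openSegment hp hq hz hseg)

theorem mem_of_sum_smul_mem_of_isExtreme {A B : Set E} (hA : Convex ℝ A) (hAB : IsExtreme ℝ A B)
    {ι : Type*} {s : Finset ι} {w : ι → ℝ} {z : ι → E} (hw : ∀ i ∈ s, 0 < w i)
    (hw₁ : ∑ i ∈ s, w i = 1) (hz : ∀ i ∈ s, z i ∈ A) (h : ∑ i ∈ s, w i • z i ∈ B)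
    {i : ι} (hi : i ∈ s) : z i ∈ B := by
  classical
  obtain hs | hs := (s.erase i).eq_empty_or_nonempty
  · obtain rfl : s = {i} := by rw [← Finset.insert_erase hi, hs, insert_empty_eq]
    simp_all
  have hpos : 0 < ∑ j ∈ s.erase i, w j :=
    Finset.sum_pos (fun j hj => hw j (Finset.mem_of_mem_erase hj)) hs
  have hmem : (s.erase i).centerMass w z ∈ A :=
    hA.centerMass_mem (fun j hj => (hw j (Finset.mem_of_mem_erase hj)).le) hpos
      fun j hj => hz j (Finset.mem_of_mem_erase hj)
  refine hAB.left_mem_of_mem_openSegment (hz i hi) hmem h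
    ⟨w i, ∑ j ∈ s.erase i, w j, hw i hi, hpos, ?_, ?_⟩
  · rw [Finset.add_sum_erase s w hi, hw₁]
  · rw [Finset.centerMass, smul_inv_smul₀ hpos.ne', Finset.add_sum_erase s (fun j => w j • z j) hi]

theorem linear_ne_zero_of_apply_ne {f : E →ᵃ[ℝ] F} {x y : E} (h : f x ≠ f y) : f.linear ≠ 0 := by
  intro hf
  refine h (sub_eq_zero.1 ?_)
  rw [← vsub_eq_sub, ← f.linearMap_vsub, hf, LinearMap.zero_apply]

end ConvexGeometry

section MeetsProperly

variable {E : Type*} [NormedAddCommGroup E] [NormedSpace ℝ E]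

theorem not_subset_zero_locus {U : Set E} (hU : IsOpen U) (hne : U.Nonempty) {f : E →ᵃ[ℝ] ℝ}
    (hf : f.linear ≠ 0) : ¬ U ⊆ {x | f x = 0} := fun h =>
  hf (by rw [AffineMap.ext_on (g := 0) (hU.affineSpan_eq_top hne) h, AffineMap.zero_linear])

theorem interior_image_isometry (g : E ≃ᵃⁱ[ℝ] E) (S : Set E) :
    interior (g '' S) = g '' interior S :=
  (g.toHomeomorph.image_interior S).symm

/-- One half of the statement that two convex sets do not cross: `K ∩ L` is extreme in `K`, and
`K` lies in `L` as soon as their interiors meet. Two sets that meet properly both ways meet in a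
common face, and coincide unless their interiors are disjoint. -/
structure MeetsProperly (K L : Set E) : Prop where
  isExtreme : IsExtreme ℝ K (K ∩ L)
  subset_of_overlap : ¬ Disjoint (interior K) (interior L) → K ⊆ L

namespace MeetsProperly

variable {K L : Set E}

theorem univ (K : Set E) : MeetsProperly K univ :=
  ⟨by rw [inter_univ], fun _ => subset_univ K⟩

theorem of_subset (h : K ⊆ L) : MeetsProperly K L :=
  ⟨by rw [inter_eq_left.2 h], fun _ => h⟩

theorem mono_left {S : Set E} (hS : S ⊆ K) (h : MeetsProperly K L) : MeetsProperly S L where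
  isExtreme := ⟨inter_subset_left, fun _ hp _ hq _ hz hseg => ⟨hp,
    (h.isExtreme.left_mem_of_mem_openSegment (hS hp) (hS hq) ⟨hS hz.1, hz.2⟩ hseg).2⟩⟩
  subset_of_overlap hd :=
    hS.trans (h.subset_of_overlap fun hd' => hd (hd'.mono_left (interior_mono hS)))

theorem inter_of_subset {M : Set E} (h : MeetsProperly K L) (hM : K ∩ L ⊆ M) :
    MeetsProperly K (L ∩ M) where
  isExtreme := by
    rw [← inter_assoc, inter_eq_left.2 hM]
    exact h.isExtreme
  subset_of_overlap hd := by
    have hKL := h.subset_of_overlap fun hd' =>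
      hd (hd'.mono_right (interior_mono inter_subset_left))
    exact subset_inter hKL fun x hx => hM ⟨hx, hKL hx⟩

theorem inter {M : Set E} (hL : MeetsProperly K L) (hM : MeetsProperly K M) :
    MeetsProperly K (L ∩ M) where
  isExtreme := inter_inter_distrib_left K L M ▸ hL.isExtreme.inter hM.isExtreme
  subset_of_overlap h := subset_inter
    (hL.subset_of_overlap fun hd => h (hd.mono_right (interior_mono inter_subset_left)))
    (hM.subset_of_overlap fun hd => h (hd.mono_right (interior_mono inter_subset_right)))

theorem iInter {κ : Sort*} {L : κ → Set E} (h : ∀ i, MeetsProperly K (L i)) :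
    MeetsProperly K (⋂ i, L i) where
  isExtreme := by
    cases isEmpty_or_nonempty κ
    · rw [iInter_of_empty, inter_univ]
    · exact inter_iInter K L ▸ isExtreme_iInter fun i => (h i).isExtreme
  subset_of_overlap hd := subset_iInter fun i =>
    (h i).subset_of_overlap fun hi => hd (hi.mono_right (interior_mono (iInter_subset L i)))

theorem inter_halfSpace (h : MeetsProperly K L) {f : E →ᵃ[ℝ] ℝ} (hf : f.linear ≠ 0)
    (hs : ∀ x ∈ K ∩ L, f x ≤ 0) : MeetsProperly K (L ∩ {x | 0 ≤ f x}) where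
  isExtreme := by
    refine ⟨inter_subset_left, ?_⟩
    rintro p hp q hq z ⟨hzK, hzL, hz⟩ hseg
    have hpL := h.isExtreme.left_mem_of_mem_openSegment hp hq ⟨hzK, hzL⟩ hseg
    have hqL := h.isExtreme.right_mem_of_mem_openSegment hp hq ⟨hzK, hzL⟩ hseg
    refine ⟨hp, hpL.2, ?_⟩
    obtain ⟨s, t, hs0, ht0, hst, rfl⟩ := hseg
    rw [mem_ofPred_eq, Convex.combo_affine_apply hst] at hz
    by_contra hlt
    exact hz.not_gt (add_neg_of_neg_of_nonpos (mul_neg_of_pos_of_neg hs0 (not_le.1 hlt))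
      (mul_nonpos_of_nonneg_of_nonpos ht0.le (hs q hqL)))
  subset_of_overlap hd := by
    refine absurd (fun x hx => ?_) (not_subset_zero_locus (isOpen_interior.inter isOpen_interior)
      (not_disjoint_iff_nonempty_inter.1 hd) hf)
    have hxL := interior_subset hx.2
    exact le_antisymm (hs x ⟨interior_subset hx.1, hxL.1⟩) hxL.2

theorem halfSpace_of_mapsTo_Icc {f : E →ᵃ[ℝ] ℝ} (hf : f.linear ≠ 0) {m : ℤ}
    (hm : MapsTo f K (Icc m (m + 1))) (k : ℤ) : MeetsProperly K {x | (k : ℝ) ≤ f x} := by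
  obtain hk | hk : k ≤ m ∨ m + 1 ≤ k := le_or_gt k m
  · exact of_subset fun x hx => (Int.cast_le.2 hk).trans (hm hx).1
  · have hset : {x | (k : ℝ) ≤ f x} = Set.univ ∩ {x | 0 ≤ (f - AffineMap.const ℝ E (k : ℝ)) x} := by
      ext x
      simp
    rw [hset]
    refine (univ K).inter_halfSpace (by simpa using hf) fun x hx => ?_
    have : ((m + 1 : ℤ) : ℝ) ≤ k := Int.cast_le.2 hk
    simpa using (hm hx.1).2.trans (mod_cast this)

theorem image (h : MeetsProperly K L) (g : E ≃ᵃⁱ[ℝ] E) : MeetsProperly (g '' K) (g '' L) where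
  isExtreme := image_inter g.injective ▸
    isExtreme_image h.isExtreme (f := g.toAffineEquiv.toAffineMap) g.injective
  subset_of_overlap hd := by
    rw [interior_image_isometry, interior_image_isometry, disjoint_image_iff g.injective] at hd
    exact image_mono (h.subset_of_overlap hd)

theorem antisymm (hKL : MeetsProperly K L) (hLK : MeetsProperly L K)
    (hd : ¬ Disjoint (interior K) (interior L)) : K = L :=
  (hKL.subset_of_overlap hd).antisymm (hLK.subset_of_overlap fun h => hd h.symm)

theorem eq_of_mem_interior (hKL : MeetsProperly K L) (hLK : MeetsProperly L K) (hL : Convex ℝ L)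
    (hne : (interior L).Nonempty) {x : E} (hxK : x ∈ interior K) (hxL : x ∈ L) : K = L := by
  refine hKL.antisymm hLK (not_disjoint_iff_nonempty_inter.2 ?_)
  have hx : x ∈ closure (interior L) :=
    hL.closure_interior_eq_closure_of_nonempty_interior hne ▸ subset_closure hxL
  exact mem_closure_iff.1 hx _ isOpen_interior hxK

end MeetsProperly

end MeetsProperly

section OrbitTiles

variable {E : Type*} [NormedAddCommGroup E] [NormedSpace ℝ E]

theorem mul_image (g h : E ≃ᵃⁱ[ℝ] E) (S : Set E) : (g * h) '' S = g '' (h '' S) := by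
  rw [AffineIsometryEquiv.coe_mul, image_comp]

theorem one_image (S : Set E) : (1 : E ≃ᵃⁱ[ℝ] E) '' S = S := by
  rw [AffineIsometryEquiv.coe_one, image_id]

variable (Γ : Subgroup (E ≃ᵃⁱ[ℝ] E)) {κ : Type*} (K : κ → Set E)

/-- The tiles generated by the prototiles `K i` under a group `Γ` of isometries. -/
def orbitTiles : Set (Set E) :=
  {L | ∃ g ∈ Γ, ∃ i, L = g '' K i}

variable {Γ K}

theorem mem_orbitTiles (i : κ) : K i ∈ orbitTiles Γ K :=
  ⟨1, Γ.one_mem, i, (one_image _).symm⟩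

theorem image_mem_orbitTiles {g : E ≃ᵃⁱ[ℝ] E} (hg : g ∈ Γ) {L : Set E}
    (hL : L ∈ orbitTiles Γ K) : g '' L ∈ orbitTiles Γ K := by
  obtain ⟨h, hh, i, rfl⟩ := hL
  exact ⟨g * h, Γ.mul_mem hg hh, i, (mul_image _ _ _).symm⟩

theorem meetsProperly_orbitTiles (hK : ∀ g ∈ Γ, ∀ i j, MeetsProperly (g '' K i) (K j))
    {L M : Set E} (hL : L ∈ orbitTiles Γ K) (hM : M ∈ orbitTiles Γ K) : MeetsProperly L M := by
  obtain ⟨g, hg, i, rfl⟩ := hL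
  obtain ⟨h, hh, j, rfl⟩ := hM
  have := (hK _ (Γ.mul_mem (Γ.inv_mem hh) hg) i j).image h
  rwa [← mul_image, mul_inv_cancel_left] at this

theorem disjoint_interior_orbitTiles (hK : ∀ g ∈ Γ, ∀ i j, MeetsProperly (g '' K i) (K j))
    {L M : Set E} (hL : L ∈ orbitTiles Γ K) (hM : M ∈ orbitTiles Γ K) (hne : L ≠ M) :
    Disjoint (interior L) (interior M) := by
  by_contra hd
  exact hne ((meetsProperly_orbitTiles hK hL hM).antisymm (meetsProperly_orbitTiles hK hM hL) hd)

theorem sUnion_orbitTiles_eq_univ (hcover : ∀ x, ∃ g ∈ Γ, x ∈ g '' ⋃ i, K i) :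
    ⋃₀ orbitTiles Γ K = univ := by
  refine eq_univ_of_forall fun x => ?_
  obtain ⟨g, hg, y, hy, rfl⟩ := hcover x
  obtain ⟨i, hi⟩ := mem_iUnion.1 hy
  exact ⟨g '' K i, ⟨g, hg, i, rfl⟩, mem_image_of_mem g hi⟩

end OrbitTiles

namespace CongruentSets

variable {T : Tetrahedron} {K : Set E3}

theorem image_right {K L : Set E3} (h : CongruentSets K L) (g : E3 ≃ᵃⁱ[ℝ] E3) :
    CongruentSets K (g '' L) := by
  obtain ⟨f, rfl⟩ := h
  exact ⟨g * f, mul_image _ _ _⟩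

theorem convex (h : CongruentSets T.body K) : Convex ℝ K := by
  obtain ⟨f, rfl⟩ := h
  exact (convex_convexHull ℝ _).affine_image f.toAffineEquiv.toAffineMap

theorem nonempty_interior (h : CongruentSets T.body K) : (interior K).Nonempty := by
  obtain ⟨f, rfl⟩ := h
  have hspan := T.independent.affineSpan_eq_top_iff_card_eq_finrank_add_one.2 (by simp)
  exact interior_image_isometry f _ ▸
    (interior_convexHull_nonempty_iff_affineSpan_eq_top.2 hspan).image f

end CongruentSets

theorem tilesIn_image_orbitTiles {Γ : Subgroup (E3 ≃ᵃⁱ[ℝ] E3)} {κ : Type*} {K : κ → Set E3}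
    {g : E3 ≃ᵃⁱ[ℝ] E3} (hg : g ∈ Γ) (P : Set E3) :
    tilesIn (orbitTiles Γ K) (g '' P) = (fun L => g '' L) '' tilesIn (orbitTiles Γ K) P := by
  ext L
  constructor
  · rintro ⟨hL, hLP⟩
    have hcancel (S : Set E3) : ⇑g⁻¹ '' (g '' S) = S := by
      rw [← mul_image, inv_mul_cancel, one_image]
    refine ⟨⇑g⁻¹ '' L, ⟨image_mem_orbitTiles (Γ.inv_mem hg) hL, ?_⟩, ?_⟩
    · exact hcancel P ▸ image_mono hLP
    · change g '' (⇑g⁻¹ '' L) = L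
      rw [← mul_image, mul_inv_cancel, one_image]
  · rintro ⟨M, ⟨hM, hMP⟩, rfl⟩
    exact ⟨image_mem_orbitTiles hg hM, image_mono hMP⟩

theorem isFaceToFaceTiling_orbitTiles {T : Tetrahedron} {Γ : Subgroup (E3 ≃ᵃⁱ[ℝ] E3)} {κ : Type*}
    {K : κ → Set E3} (hT : ∀ i, CongruentSets T.body (K i))
    (hcover : ∀ x, ∃ g ∈ Γ, x ∈ g '' ⋃ i, K i)
    (hmeet : ∀ g ∈ Γ, ∀ i j, MeetsProperly (g '' K i) (K j)) :
    IsFaceToFaceTiling T (orbitTiles Γ K) := by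
  have hcongr : ∀ L ∈ orbitTiles Γ K, CongruentSets T.body L := by
    rintro _ ⟨g, -, i, rfl⟩
    exact (hT i).image_right g
  have hface : ∀ L ∈ orbitTiles Γ K, ∀ M ∈ orbitTiles Γ K, IsFaceOf (L ∩ M) L := fun L hL M hM =>
    ⟨(hcongr L hL).convex.inter (hcongr M hM).convex,
      (meetsProperly_orbitTiles hmeet hL hM).isExtreme⟩
  exact ⟨hcongr, sUnion_orbitTiles_eq_univ hcover,
    fun L hL M hM => disjoint_interior_orbitTiles hmeet hL hM,
    fun L hL M hM => ⟨hface L hL M hM, inter_comm M L ▸ hface M hM L hL⟩⟩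

section LinearDet

variable {V : Type*} [NormedAddCommGroup V] [NormedSpace ℝ V]

/-- The determinant of the linear part of an affine isometry. -/
noncomputable def linearDet : (V ≃ᵃⁱ[ℝ] V) →* ℝ where
  toFun g := LinearMap.det (g.linearIsometryEquiv.toLinearEquiv : V →ₗ[ℝ] V)
  map_one' := LinearMap.det_id
  map_mul' _ _ := LinearMap.det_comp _ _

end LinearDet

theorem isDirectIsometry_iff {g : E3 ≃ᵃⁱ[ℝ] E3} : IsDirectIsometry g ↔ 0 < linearDet g := Iff.rfl

namespace IsDirectIsometry

variable {g h : E3 ≃ᵃⁱ[ℝ] E3}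

theorem one : IsDirectIsometry 1 := by
  rw [isDirectIsometry_iff, map_one]
  exact one_pos

theorem mul (hg : IsDirectIsometry g) (hh : IsDirectIsometry h) : IsDirectIsometry (g * h) := by
  rw [isDirectIsometry_iff, map_mul]
  exact mul_pos hg hh

theorem inv (hg : IsDirectIsometry g) : IsDirectIsometry g⁻¹ := by
  have hmul : linearDet g * linearDet g⁻¹ = 1 := by rw [← map_mul, mul_inv_cancel, map_one]
  exact pos_of_mul_pos_right (hmul ▸ one_pos) hg.le

theorem zpow (hg : IsDirectIsometry g) (n : ℤ) : IsDirectIsometry (g ^ n) := by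
  have hpow (m : ℕ) : IsDirectIsometry (g ^ m) := by
    rw [isDirectIsometry_iff, map_pow]
    exact pow_pos hg m
  obtain ⟨m, rfl | rfl⟩ := n.eq_nat_or_neg
  · exact zpow_natCast g m ▸ hpow m
  · exact zpow_neg g m ▸ zpow_natCast g m ▸ (hpow m).inv

theorem conj (hh : IsDirectIsometry h) (g : E3 ≃ᵃⁱ[ℝ] E3) : IsDirectIsometry (g * h * g⁻¹) := by
  rwa [isDirectIsometry_iff, map_mul, mul_comm, ← map_mul, inv_mul_cancel_left]

end IsDirectIsometry

namespace DirectlyCongruent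

variable {K L M : Set E3}

theorem symm (h : DirectlyCongruent K L) : DirectlyCongruent L K := by
  obtain ⟨g, hg, rfl⟩ := h
  exact ⟨g⁻¹, hg.inv, by rw [← mul_image, inv_mul_cancel, one_image]⟩

theorem trans (h₁ : DirectlyCongruent K L) (h₂ : DirectlyCongruent L M) :
    DirectlyCongruent K M := by
  obtain ⟨g, hg, rfl⟩ := h₁
  obtain ⟨h, hh, rfl⟩ := h₂
  exact ⟨h * g, hh.mul hg, mul_image _ _ _⟩

theorem congruentSets (h : DirectlyCongruent K L) : CongruentSets K L :=
  h.imp fun _ => And.right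

theorem image (h : DirectlyCongruent K L) (g : E3 ≃ᵃⁱ[ℝ] E3) :
    DirectlyCongruent (g '' K) (g '' L) := by
  obtain ⟨f, hf, rfl⟩ := h
  exact ⟨g * f * g⁻¹, hf.conj g, by rw [← mul_image, inv_mul_cancel_right, mul_image]⟩

end DirectlyCongruent

/-- An affine frame whose basis vectors have equal lengths and equal mutual inner products, so that
permutations of the coordinates are isometries. -/
structure SymmetricFrame (ι E : Type*) [NormedAddCommGroup E] [InnerProductSpace ℝ E] where
  origin : E
  basis : Module.Basis ι ℝ E
  sq : ℝ
  prod : ℝ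
  inner_self : ∀ i, inner ℝ (basis i) (basis i) = sq
  inner_of_ne : ∀ i j, i ≠ j → inner ℝ (basis i) (basis j) = prod

namespace SymmetricFrame

section Chart

variable {ι E : Type*} [NormedAddCommGroup E] [InnerProductSpace ℝ E]
  (F : SymmetricFrame ι E)

theorem prod_lt_sq [Nontrivial ι] : F.prod < F.sq := by
  obtain ⟨i, j, hij⟩ := exists_pair_ne ι
  have h : 0 < inner ℝ (F.basis i - F.basis j) (F.basis i - F.basis j) :=
    real_inner_self_pos.2 (sub_ne_zero.2 (F.basis.injective.ne hij))
  simp only [inner_sub_left, inner_sub_right, F.inner_self, F.inner_of_ne i j hij,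
    F.inner_of_ne j i hij.symm] at h
  linarith

variable [Fintype ι]

/-- The affine coordinates of a frame. -/
noncomputable def chart : E ≃ᵃ[ℝ] (ι → ℝ) :=
  (AffineEquiv.vaddConst ℝ F.origin).symm.trans F.basis.equivFun.toAffineEquiv

theorem chart_apply (x : E) : F.chart x = F.basis.equivFun (x - F.origin) := rfl

theorem chart_sub (x y : E) : F.chart x - F.chart y = F.basis.equivFun (x - y) := by
  rw [chart_apply, chart_apply, ← map_sub, sub_sub_sub_cancel_right]

theorem chart_ext {x y : E} (h : ∀ i, F.chart x i = F.chart y i) : x = y :=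
  F.chart.injective (funext h)

/-- The coordinates of a frame as affine functionals. -/
noncomputable def coord (i : ι) : E →ᵃ[ℝ] ℝ :=
  (LinearMap.proj i).toAffineMap.comp F.chart.toAffineMap

theorem coord_apply (i : ι) (x : E) : F.coord i x = F.chart x i := rfl

theorem coord_linear_ne_zero (i : ι) : (F.coord i).linear ≠ 0 :=
  linear_ne_zero_of_apply_ne (x := F.chart.symm 1) (y := F.chart.symm 0) (by simp [coord_apply])

theorem coord_sub_coord_linear_ne_zero {i j : ι} (h : i ≠ j) :
    (F.coord i - F.coord j).linear ≠ 0 := by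
  classical
  exact linear_ne_zero_of_apply_ne (x := F.chart.symm (Pi.single i 1)) (y := F.chart.symm 0)
    (by simp [coord_apply, h.symm])

theorem inner_eq (v w : E) :
    inner ℝ v w = (F.sq - F.prod) * ∑ i, F.basis.equivFun v i * F.basis.equivFun w i
      + F.prod * ((∑ i, F.basis.equivFun v i) * ∑ i, F.basis.equivFun w i) := by
  classical
  have hgram (i j : ι) : inner ℝ (F.basis i) (F.basis j)
      = (if i = j then F.sq - F.prod else 0) + F.prod := by
    split_ifs with h
    · rw [h, F.inner_self, sub_add_cancel]
    · rw [F.inner_of_ne i j h, zero_add]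
  conv_lhs => rw [← F.basis.sum_equivFun v, ← F.basis.sum_equivFun w]
  simp only [sum_inner, inner_sum, real_inner_smul_left, real_inner_smul_right, hgram, mul_add,
    mul_ite, mul_zero, Finset.sum_add_distrib, Finset.sum_ite_eq', Finset.mem_univ, if_true,
    Finset.mul_sum]
  refine congrArg₂ (· + ·) (Finset.sum_congr rfl fun i _ => by ring) ?_
  refine Finset.sum_congr rfl fun i _ => ?_
  rw [Finset.sum_mul, Finset.mul_sum]
  exact Finset.sum_congr rfl fun j _ => by ring

theorem dist_sq_eq (x y : E) :
    dist x y ^ 2 = (F.sq - F.prod) * ∑ i, (F.chart x i - F.chart y i) ^ 2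
      + F.prod * (∑ i, (F.chart x i - F.chart y i)) ^ 2 := by
  rw [dist_eq_norm, ← real_inner_self_eq_norm_sq, F.inner_eq, ← F.chart_sub]
  simp only [Pi.sub_apply, pow_two]

theorem exists_isometry {ε : ℝ} (hε : ε ^ 2 = 1) (n : ι → ℝ) (σ : Equiv.Perm ι) :
    ∃ g : E ≃ᵃⁱ[ℝ] E, ∀ x i, F.chart (g x) i = n i + ε * F.chart x (σ i) := by
  rw [pow_two] at hε
  let e : E ≃ E :=
    { toFun := fun x => F.chart.symm fun i => n i + ε * F.chart x (σ i)
      invFun := fun y => F.chart.symm fun i => ε * (F.chart y (σ.symm i) - n (σ.symm i))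
      left_inv := fun x => F.chart_ext fun i => by simp [← mul_assoc, hε]
      right_inv := fun x => F.chart_ext fun i => by simp [← mul_assoc, hε] }
  have he : ∀ x i, F.chart (e x) i = n i + ε * F.chart x (σ i) := fun x i => by simp [e]
  have hsub (x y : E) (i : ι) : F.chart (e x) i - F.chart (e y) i
      = ε * (F.chart x (σ i) - F.chart y (σ i)) := by rw [he, he]; ring
  have hiso : Isometry e := by
    refine Isometry.of_dist_eq fun x y => ?_
    rw [← sq_eq_sq₀ dist_nonneg dist_nonneg, F.dist_sq_eq, F.dist_sq_eq]
    simp only [hsub, mul_pow, ← Finset.mul_sum, pow_two ε, hε, one_mul]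
    rw [Equiv.sum_comp σ fun i => (F.chart x i - F.chart y i) ^ 2,
      Equiv.sum_comp σ fun i => F.chart x i - F.chart y i]
  exact ⟨(IsometryEquiv.mk e hiso).toRealAffineIsometryEquiv, he⟩

theorem linearDet_eq [DecidableEq ι] {g : E ≃ᵃⁱ[ℝ] E} {ε : ℝ} {n : ι → ℝ} {σ : Equiv.Perm ι}
    (hg : ∀ x i, F.chart (g x) i = n i + ε * F.chart x (σ i)) :
    linearDet g = ε ^ Fintype.card ι * (Equiv.Perm.sign σ : ℤ) := by
  have hlin (v : E) (i : ι) : F.basis.equivFun (g.linearIsometryEquiv v) i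
      = ε * F.basis.equivFun v (σ i) := by
    have hv : v = (v + F.origin) -ᵥ F.origin := by simp
    rw [hv, g.map_vsub, vsub_eq_sub, vsub_eq_sub, ← F.chart_sub, ← F.chart_sub, Pi.sub_apply,
      Pi.sub_apply, hg, hg]
    ring
  have hconj : (F.basis.equivFun : E →ₗ[ℝ] ι → ℝ) ∘ₗ
      (g.linearIsometryEquiv.toLinearEquiv : E →ₗ[ℝ] E) ∘ₗ
      (F.basis.equivFun.symm : (ι → ℝ) →ₗ[ℝ] E) = ε • Matrix.toLin' (σ.permMatrix ℝ) := by
    refine LinearMap.ext fun c => funext fun i => ?_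
    simpa only [LinearMap.comp_apply, LinearEquiv.coe_coe, LinearEquiv.apply_symm_apply,
      LinearIsometryEquiv.coe_toLinearEquiv, LinearMap.smul_apply, Matrix.toLin'_apply,
      Matrix.permMatrix_mulVec, Pi.smul_apply, smul_eq_mul, Function.comp_apply] using
      hlin (F.basis.equivFun.symm c) i
  change LinearMap.det (g.linearIsometryEquiv.toLinearEquiv : E →ₗ[ℝ] E) = _
  rw [← LinearMap.det_conj _ F.basis.equivFun, hconj, LinearMap.det_smul, LinearMap.det_toLin',
    Matrix.det_permutation, Module.finrank_pi]

/-- The isometries that act on the coordinates by a permutation followed by an integral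
translation. -/
def group : Subgroup (E ≃ᵃⁱ[ℝ] E) where
  carrier := {g | ∃ (n : ι → ℤ) (σ : Equiv.Perm ι), ∀ x i, F.chart (g x) i = n i + F.chart x (σ i)}
  one_mem' := ⟨0, 1, fun x i => by simp⟩
  mul_mem' := by
    rintro g g' ⟨n, σ, h⟩ ⟨m, τ, h'⟩
    refine ⟨fun i => n i + m (σ i), σ.trans τ, fun x i => ?_⟩
    rw [AffineIsometryEquiv.coe_mul, Function.comp_apply, h, h', Int.cast_add, add_assoc,
      Equiv.trans_apply]
  inv_mem' := by
    rintro g ⟨n, σ, h⟩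
    refine ⟨fun i => - n (σ.symm i), σ.symm, fun x i => ?_⟩
    have := h (g⁻¹ x) (σ.symm i)
    rw [← Function.comp_apply (f := g), ← AffineIsometryEquiv.coe_mul, mul_inv_cancel,
      AffineIsometryEquiv.coe_one, id_eq, σ.apply_symm_apply] at this
    push_cast
    linarith

theorem exists_mem_group (n : ι → ℤ) (σ : Equiv.Perm ι) :
    ∃ g ∈ F.group, ∀ x i, F.chart (g x) i = n i + F.chart x (σ i) := by
  obtain ⟨g, hg⟩ := F.exists_isometry (one_pow 2) (fun i => n i) σ
  simp only [one_mul] at hg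
  exact ⟨g, ⟨n, σ, hg⟩, hg⟩

/-- The image of a frame under an isometry. -/
noncomputable def map (g : E ≃ᵃⁱ[ℝ] E) : SymmetricFrame ι E where
  origin := g F.origin
  basis := F.basis.map g.linearIsometryEquiv.toLinearEquiv
  sq := F.sq
  prod := F.prod
  inner_self i := by
    simpa only [Module.Basis.map_apply, LinearIsometryEquiv.coe_toLinearEquiv] using
      (g.linearIsometryEquiv.inner_map_map _ _).trans (F.inner_self i)
  inner_of_ne i j h := by
    simpa only [Module.Basis.map_apply, LinearIsometryEquiv.coe_toLinearEquiv] using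
      (g.linearIsometryEquiv.inner_map_map _ _).trans (F.inner_of_ne i j h)

theorem chart_map_apply (g : E ≃ᵃⁱ[ℝ] E) (x : E) : (F.map g).chart (g x) = F.chart x := by
  have h : g x - g F.origin = g.linearIsometryEquiv (x - F.origin) := (g.map_vsub _ _).symm
  change (F.basis.map g.linearIsometryEquiv.toLinearEquiv).equivFun (g x - g F.origin) = _
  rw [h, chart_apply]
  ext i
  simp

theorem group_map_le {g : E ≃ᵃⁱ[ℝ] E} (hg : g ∈ F.group) : (F.map g).group ≤ F.group := by
  rintro h ⟨n, σ, hσ⟩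
  have hmem : g⁻¹ * h * g ∈ F.group := by
    refine ⟨n, σ, fun x i => ?_⟩
    have e : g ((g⁻¹ * h * g) x) = h (g x) :=
      DFunLike.congr_fun (by group : g * (g⁻¹ * h * g) = h * g) x
    rw [← chart_map_apply F g, e, hσ, chart_map_apply]
  have := F.group.mul_mem (F.group.mul_mem hg hmem) (F.group.inv_mem hg)
  rwa [show g * (g⁻¹ * h * g) * g⁻¹ = h by group] at this

end Chart

section Chambers

variable {ι E : Type*} [NormedAddCommGroup E] [InnerProductSpace ℝ E] [Fintype ι]
  [LinearOrder ι] (F : SymmetricFrame ι E)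

/-- The order simplex of a frame. For the three edge vectors of a path this is the tetrahedron
`1 ≥ x₀ ≥ x₁ ≥ x₂ ≥ 0` spanned by the path. -/
def simplex : Set E :=
  {x | Antitone (F.chart x) ∧ ∀ i, F.chart x i ∈ Icc (0 : ℝ) 1}

/-- The union of the translates of the order simplex, and of its images under cyclic rotations of
the coordinates, along the direction `(1, …, 1)`. -/
def column : Set E :=
  {x | Antitone (F.chart x) ∧ ∀ i j, F.chart x i ≤ F.chart x j + 1}

variable {F}

theorem simplex_subset_column : F.simplex ⊆ F.column := fun x hx =>
  ⟨hx.1, fun i j => by linarith [(hx.2 i).2, (hx.2 j).1]⟩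

theorem column_map (g : E ≃ᵃⁱ[ℝ] E) : (F.map g).column = g '' F.column := by
  ext x
  obtain ⟨x, rfl⟩ := g.surjective x
  rw [g.injective.mem_set_image, column, column, mem_ofPred_eq, mem_ofPred_eq, chart_map_apply]

theorem exists_mapsTo_coord {g : E ≃ᵃⁱ[ℝ] E} (hg : g ∈ F.group) (i : ι) :
    ∃ m : ℤ, MapsTo (F.coord i) (g '' F.simplex) (Icc m (m + 1)) := by
  obtain ⟨n, σ, hσ⟩ := hg
  refine ⟨n i, ?_⟩
  rintro _ ⟨y, hy, rfl⟩
  rw [coord_apply, hσ]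
  exact ⟨le_add_of_nonneg_right (hy.2 _).1, add_le_add_right (hy.2 _).2 _⟩

theorem exists_mapsTo_coord_sub_coord {g : E ≃ᵃⁱ[ℝ] E} (hg : g ∈ F.group) (i j : ι) :
    ∃ m : ℤ, MapsTo (F.coord i - F.coord j) (g '' F.column) (Icc m (m + 1)) := by
  obtain ⟨n, σ, hσ⟩ := hg
  obtain h | h := le_total (σ i) (σ j)
  · refine ⟨n i - n j, ?_⟩
    rintro _ ⟨y, hy, rfl⟩
    simp only [AffineMap.coe_sub, Pi.sub_apply, coord_apply, hσ, Int.cast_sub]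
    constructor <;> linarith [hy.1 h, hy.2 (σ i) (σ j)]
  · refine ⟨n i - n j - 1, ?_⟩
    rintro _ ⟨y, hy, rfl⟩
    simp only [AffineMap.coe_sub, Pi.sub_apply, coord_apply, hσ, Int.cast_sub, Int.cast_one]
    constructor <;> linarith [hy.1 h, hy.2 (σ j) (σ i)]

theorem meetsProperly_setOf_le_sub {g : E ≃ᵃⁱ[ℝ] E} (hg : g ∈ F.group) {i j : ι}
    (hij : i ≠ j) (k : ℤ) :
    MeetsProperly (g '' F.column) {x | (k : ℝ) ≤ F.chart x i - F.chart x j} := by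
  obtain ⟨m, hm⟩ := exists_mapsTo_coord_sub_coord hg i j
  exact MeetsProperly.halfSpace_of_mapsTo_Icc (F.coord_sub_coord_linear_ne_zero hij) hm k

theorem meetsProperly_antitone {g : E ≃ᵃⁱ[ℝ] E} (hg : g ∈ F.group) :
    MeetsProperly (g '' F.column) {x | Antitone (F.chart x)} := by
  have hset : {x | Antitone (F.chart x)}
      = ⋂ (i) (j) (_ : i < j), {x | ((0 : ℤ) : ℝ) ≤ F.chart x i - F.chart x j} := by
    ext x
    simp [antitone_iff_forall_lt]
  rw [hset]
  exact .iInter fun i => .iInter fun j => .iInter fun h => meetsProperly_setOf_le_sub hg h.ne 0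

theorem meetsProperly_column {g : E ≃ᵃⁱ[ℝ] E} (hg : g ∈ F.group) :
    MeetsProperly (g '' F.column) F.column := by
  have hset : F.column = {x | Antitone (F.chart x)} ∩
      ⋂ (i) (j) (_ : j ≠ i), {x | ((-1 : ℤ) : ℝ) ≤ F.chart x j - F.chart x i} := by
    ext x
    simp only [column, mem_ofPred_eq, mem_inter_iff, mem_iInter]
    refine and_congr_right fun _ => forall₂_congr fun i j => ⟨fun h _ => ?_, fun h => ?_⟩
    · push_cast
      linarith
    · obtain rfl | hij := eq_or_ne j i
      · linarith
      · have := h hij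
        push_cast at this
        linarith
  nth_rw 2 [hset]
  exact (meetsProperly_antitone hg).inter <| .iInter fun i => .iInter fun j =>
    .iInter fun hij => meetsProperly_setOf_le_sub hg hij (-1)

theorem meetsProperly_simplex {g : E ≃ᵃⁱ[ℝ] E} (hg : g ∈ F.group) :
    MeetsProperly (g '' F.simplex) F.simplex := by
  have hset : F.simplex = {x | Antitone (F.chart x)} ∩
      ⋂ i, {x | ((0 : ℤ) : ℝ) ≤ F.coord i x} ∩ {x | ((-1 : ℤ) : ℝ) ≤ (-F.coord i) x} := by
    ext x
    simp [simplex, coord_apply]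
  nth_rw 2 [hset]
  refine ((meetsProperly_antitone hg).mono_left (image_mono simplex_subset_column)).inter <|
    .iInter fun i => ?_
  obtain ⟨m, hm⟩ := exists_mapsTo_coord hg i
  refine (MeetsProperly.halfSpace_of_mapsTo_Icc (F.coord_linear_ne_zero i) hm 0).inter
    (MeetsProperly.halfSpace_of_mapsTo_Icc (m := -m - 1) ?_ (fun x hx => ?_) (-1))
  · exact neg_ne_zero.2 (F.coord_linear_ne_zero i)
  · have := hm hx
    simp only [mem_Icc, AffineMap.coe_neg, Pi.neg_apply, Int.cast_sub, Int.cast_neg,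
      Int.cast_one] at this ⊢
    constructor <;> linarith

end Chambers

theorem exists_mem_image_simplex {E : Type*} [NormedAddCommGroup E] [InnerProductSpace ℝ E] {k : ℕ}
    (F : SymmetricFrame (Fin k) E) (x : E) : ∃ g ∈ F.group, x ∈ g '' F.simplex := by
  let y : Fin k → ℝ := fun i => Int.fract (F.chart x i)
  let τ : Equiv.Perm (Fin k) := Fin.revPerm.trans (Tuple.sort y)
  obtain ⟨g, hg, hgx⟩ := F.exists_mem_group (fun i => ⌊F.chart x i⌋) τ.symm
  refine ⟨g, hg, F.chart.symm (y ∘ τ), ⟨?_, fun i => ?_⟩, F.chart_ext fun i => ?_⟩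
  · rw [F.chart.apply_symm_apply]
    exact fun i j hij => Tuple.monotone_sort y (Fin.rev_le_rev.2 hij)
  · rw [F.chart.apply_symm_apply]
    exact ⟨Int.fract_nonneg _, (Int.fract_lt_one _).le⟩
  · rw [hgx, F.chart.apply_symm_apply, Function.comp_apply, τ.apply_symm_apply,
      Int.floor_add_fract]

end SymmetricFrame

section AffineGeometry

variable {V : Type*}

theorem affineIndependent_of_sum_smul_eq_zero [AddCommGroup V] [Module ℝ V] {ι : Type*} [Fintype ι]
    {p : ι → V} (h : ∀ w : ι → ℝ, ∑ i, w i = 0 → ∑ i, w i • p i = 0 → ∀ i, w i = 0) :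
    AffineIndependent ℝ p := by
  rw [affineIndependent_iff_of_fintype]
  intro w hw hw'
  rw [Finset.weightedVSub_eq_linear_combination _ hw] at hw'
  exact h w hw hw'

variable [NormedAddCommGroup V] [InnerProductSpace ℝ V]

theorem reflection_eq_of_midpoint_mem {s : AffineSubspace ℝ V} [Nonempty s]
    [s.direction.HasOrthogonalProjection] {p q : V} (hm : midpoint ℝ p q ∈ s)
    (ho : q - p ∈ s.directionᗮ) : EuclideanGeometry.reflection s p = q := by
  have hproj : (EuclideanGeometry.orthogonalProjection s p : V) = midpoint ℝ p q := by
    rw [EuclideanGeometry.coe_orthogonalProjection_eq_iff_mem, left_vsub_midpoint]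
    refine ⟨hm, Submodule.smul_mem _ _ ?_⟩
    rw [vsub_eq_sub, ← neg_sub]
    exact Submodule.neg_mem _ ho
  rw [EuclideanGeometry.reflection_apply', hproj, midpoint_vsub_left, vadd_eq_add, vsub_eq_sub,
    midpoint_eq_smul_add, invOf_eq_inv]
  module

end AffineGeometry

namespace SymmetricFrame

theorem inner_basis_sub {ι E : Type*} [NormedAddCommGroup E] [InnerProductSpace ℝ E] [Finite ι]
    (F : SymmetricFrame ι E) (i j : ι) (v : E) :
    inner ℝ (F.basis i - F.basis j) v
      = (F.sq - F.prod) * (F.basis.equivFun v i - F.basis.equivFun v j) := by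
  classical
  cases nonempty_fintype ι
  simp [F.inner_eq, sub_mul, Finset.sum_sub_distrib, Finsupp.single_apply]

section Chart

variable {ι E : Type*} [NormedAddCommGroup E] [InnerProductSpace ℝ E] [Fintype ι]
  (F : SymmetricFrame ι E)

theorem chart_combo {s t : ℝ} (hst : s + t = 1) (x y : E) (i : ι) :
    F.chart (s • x + t • y) i = s * F.chart x i + t * F.chart y i :=
  Convex.combo_affine_apply (f := F.coord i) hst

theorem chart_sum {κ : Type*} [Fintype κ] {w : κ → ℝ} (hw : ∑ j, w j = 1) (p : κ → E) (i : ι) :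
    F.chart (∑ j, w j • p j) i = ∑ j, w j * F.chart (p j) i := by
  have h : ∑ j, w j • p j - F.origin = ∑ j, w j • (p j - F.origin) := by
    simp only [smul_sub, Finset.sum_sub_distrib, ← Finset.sum_smul, hw, one_smul]
  simp only [chart_apply, h, map_sum, map_smul, Finset.sum_apply, Pi.smul_apply, smul_eq_mul]

theorem affineIndependent_of_chart {κ : Type*} [Fintype κ] {p : κ → E}
    (h : ∀ w : κ → ℝ, ∑ j, w j = 0 → (∀ i, ∑ j, w j * F.chart (p j) i = 0) → ∀ j, w j = 0) :
    AffineIndependent ℝ p := by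
  rw [← F.chart.affineIndependent_iff]
  refine affineIndependent_of_sum_smul_eq_zero fun w hw hsum => h w hw fun i => ?_
  simpa only [Finset.sum_apply, Pi.smul_apply, smul_eq_mul, Function.comp_apply,
    Pi.zero_apply] using congrFun hsum i

theorem reflection_mem_group [FiniteDimensional ℝ E] {s : AffineSubspace ℝ E} [Nonempty s]
    {i j : ι} (hij : i ≠ j) {k : ℤ} (hs : ∀ x, x ∈ s ↔ F.chart x i - F.chart x j = k) :
    EuclideanGeometry.reflection s ∈ F.group := by
  classical
  obtain ⟨g, hg, hgx⟩ := F.exists_mem_group (Pi.single i k - Pi.single j k) (Equiv.swap i j)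
  suffices EuclideanGeometry.reflection s = g by rwa [this]
  ext1 x
  have hi : F.chart (g x) i = k + F.chart x j := by simp [hgx, hij]
  have hj : F.chart (g x) j = -k + F.chart x i := by simp [hgx, hij.symm]
  have hdiff : g x - x = (k + F.chart x j - F.chart x i) • (F.basis i - F.basis j) := by
    apply F.basis.equivFun.injective
    rw [← F.chart_sub]
    ext l
    obtain rfl | hl := eq_or_ne l i
    · simp [hi, hij, sub_eq_add_neg]
    obtain rfl | hl' := eq_or_ne l j
    · simp [hj, hij]; ring
    · simp [hgx, hl, hl', Equiv.swap_apply_of_ne_of_ne]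
  refine reflection_eq_of_midpoint_mem ((hs _).2 ?_) fun v hv => ?_
  · have hmid (l) : F.chart (midpoint ℝ x (g x)) l = (F.chart x l + F.chart (g x) l) / 2 := by
      rw [← F.coord_apply, AffineMap.map_midpoint, midpoint_eq_smul_add, invOf_eq_inv, smul_eq_mul,
        inv_mul_eq_div, coord_apply, coord_apply]
    rw [hmid, hmid, hi, hj]
    ring
  · obtain ⟨p, hp, q, hq, rfl⟩ := (AffineSubspace.mem_direction_iff_eq_vsub
      ⟨_, SetLike.coe_mem (Classical.arbitrary s)⟩ _).1 hv
    rw [hdiff, real_inner_comm, real_inner_smul_left, F.inner_basis_sub, vsub_eq_sub,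
      ← F.chart_sub, Pi.sub_apply, Pi.sub_apply, sub_sub_sub_comm, (hs p).1 hp, (hs q).1 hq,
      sub_self, mul_zero, mul_zero]

end Chart

theorem mem_prismAxis {B : Affine.Triangle ℝ E3} {v : E3} :
    v ∈ prismAxis B ↔ ∀ i : Fin 3, inner ℝ (B.points (i + 2) - B.points (i + 1)) v = 0 := by
  constructor
  · exact fun h i => (Submodule.mem_orthogonal _ _).1 h _
      (vsub_mem_vectorSpan ℝ (mem_range_self _) (mem_range_self _))
  · intro h
    rw [prismAxis, vectorSpan_range_eq_span_range_vsub_right ℝ B.points 0,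
      ← Submodule.span_singleton_le_iff_mem, Submodule.le_orthogonal_iff_le_orthogonal,
      Submodule.span_le]
    rintro _ ⟨j, rfl⟩
    rw [SetLike.mem_coe, Submodule.mem_orthogonal_singleton_iff_inner_left]
    fin_cases j
    · exact (congrArg (inner ℝ · v) (sub_self _)).trans (inner_zero_left v)
    · exact h 2
    · exact (congrArg (inner ℝ · v) (neg_sub _ _).symm).trans
        ((inner_neg_left _ v).trans (neg_eq_zero.2 (h 1)))

section Prism

variable (F : SymmetricFrame (Fin 3) E3)

theorem mem_column {x : E3} : x ∈ F.column ↔ F.chart x 1 ≤ F.chart x 0 ∧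
    F.chart x 2 ≤ F.chart x 1 ∧ F.chart x 0 ≤ F.chart x 2 + 1 := by
  rw [column, mem_ofPred_eq, Fin.antitone_iff_succ_le, Fin.forall_fin_two]
  refine ⟨fun h => ⟨h.1.1, h.1.2, h.2 0 2⟩, fun h => ⟨⟨h.1, h.2.1⟩, fun i j => ?_⟩⟩
  obtain ⟨h10, h21, h02⟩ := h
  fin_cases i <;> fin_cases j <;> simp only [Fin.zero_eta, Fin.mk_one, Fin.reduceFinMk] <;> linarith

theorem convex_column : Convex ℝ F.column := by
  intro x hx y hy s t hs ht hst
  rw [mem_column] at hx hy ⊢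
  simp only [F.chart_combo hst]
  refine ⟨?_, ?_, ?_⟩ <;> nlinarith

/-- The orthogonal cross-section of the column through the origin of the frame. Its vertices are
those of the order simplex, `0`, `e₀` and `e₀ + e₁`, projected along the axis. -/
noncomputable def base : Affine.Triangle ℝ E3 where
  points (j : Fin 3) := F.chart.symm
    (![![0, 0, 0], ![2 / 3, -1 / 3, -1 / 3], ![1 / 3, 1 / 3, -2 / 3]] j)
  independent := by
    refine F.affineIndependent_of_chart (κ := Fin 3) fun w hw h => ?_
    simp only [AffineEquiv.apply_symm_apply, Fin.sum_univ_three] at hw h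
    have h0 := h 0
    have h1 := h 1
    simp only [Matrix.cons_val] at h0 h1
    intro j
    fin_cases j <;> simp only [Fin.zero_eta, Fin.mk_one, Fin.reduceFinMk] <;> linarith

theorem chart_base (j : Fin 3) : F.chart (F.base.points j) =
    ![![0, 0, 0], ![2 / 3, -1 / 3, -1 / 3], ![1 / 3, 1 / 3, -2 / 3]] j := by
  simp only [base, AffineEquiv.apply_symm_apply]

theorem equivFun_base_sub (i j : Fin 3) :
    F.basis.equivFun (F.base.points (i + 2) - F.base.points (i + 1)) j
      = if j = i + 1 then 2 / 3 else -1 / 3 := by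
  rw [← F.chart_sub, Pi.sub_apply, chart_base, chart_base]
  fin_cases i <;> fin_cases j <;> simp <;> norm_num

theorem inner_base_sub (i : Fin 3) (v : E3) :
    inner ℝ (F.base.points (i + 2) - F.base.points (i + 1)) v = (F.sq - F.prod) *
      (F.basis.equivFun v (i + 1) - (∑ j, F.basis.equivFun v j) / 3) := by
  simp only [F.inner_eq, equivFun_base_sub]
  fin_cases i <;> simp [Fin.sum_univ_three] <;> ring

theorem equilateral_base : F.base.Equilateral := by
  have h (i j : Fin 3) (hij : i ≠ j) :
      dist (F.base.points i) (F.base.points j) ^ 2 = (F.sq - F.prod) * (2 / 3) := by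
    rw [F.dist_sq_eq, F.chart_base, F.chart_base]
    fin_cases i <;> fin_cases j <;> simp [Fin.sum_univ_three] at hij ⊢ <;> ring
  refine ⟨√((F.sq - F.prod) * (2 / 3)), fun i j hij => ?_⟩
  rw [← h i j hij, Real.sqrt_sq dist_nonneg]

theorem mem_prismAxis_base {v : E3} :
    v ∈ prismAxis F.base ↔ ∃ c, ∀ i, F.basis.equivFun v i = c := by
  simp only [mem_prismAxis, inner_base_sub, mul_eq_zero, (sub_pos.2 F.prod_lt_sq).ne', false_or,
    sub_eq_zero, (Equiv.addRight (1 : Fin 3)).forall_congr_left (p := fun i =>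
      F.basis.equivFun v (i + 1) = _), Equiv.addRight_symm, Equiv.coe_addRight,
      neg_add_cancel_right]
  refine ⟨fun h => ⟨_, h⟩, ?_⟩
  rintro ⟨c, hc⟩ i
  simp only [hc, Finset.sum_const, Finset.card_univ, Fintype.card_fin, nsmul_eq_mul]
  norm_num

theorem prism_base : prism F.base = F.column := by
  ext x
  constructor
  · rintro ⟨y, hy, v, hv, rfl⟩
    have hy' : y ∈ F.column := by
      refine convexHull_min (range_subset_iff.2 fun j => ?_) F.convex_column hy
      rw [mem_column, chart_base]
      fin_cases j <;> simp <;> norm_num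
    obtain ⟨c, hc⟩ := F.mem_prismAxis_base.1 hv
    have hyv (i) : F.chart (y + v) i = F.chart y i + c := by
      rw [chart_apply, chart_apply, add_sub_right_comm, map_add, Pi.add_apply, hc]
    simpa only [mem_column, hyv, add_le_add_iff_right, add_right_comm _ c] using hy'
  · intro hx
    obtain ⟨h10, h21, h02⟩ := F.mem_column.1 hx
    let w : Fin 3 → ℝ :=
      ![1 - (F.chart x 0 - F.chart x 2), F.chart x 0 - F.chart x 1, F.chart x 1 - F.chart x 2]
    have hw0 (j) : 0 ≤ w j := by fin_cases j <;> simp [w] <;> linarith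
    have hw1 : ∑ j, w j = 1 := by simp [w, Fin.sum_univ_three]; ring
    refine ⟨∑ j, w j • F.base.points j, ?_, x - ∑ j, w j • F.base.points j, ?_, by abel⟩
    · exact (convex_convexHull ℝ _).sum_mem (fun j _ => hw0 j) hw1
        fun j _ => subset_convexHull ℝ _ (mem_range_self j)
    · refine F.mem_prismAxis_base.2 ⟨(∑ i, F.chart x i) / 3, fun i => ?_⟩
      rw [← F.chart_sub, Pi.sub_apply, F.chart_sum hw1 F.base.points]
      simp only [Fin.sum_univ_three, chart_base, w]
      fin_cases i <;> simp <;> ring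

theorem mem_direction_prismWall_base {i : Fin 3} {v : E3} :
    v ∈ (prismWall F.base i).direction ↔
      F.basis.equivFun v i = F.basis.equivFun v (i + 2) := by
  have hi : ∀ i : Fin 3, i ≠ i + 1 ∧ i + 2 ≠ i + 1 := by decide
  have hd := F.equivFun_base_sub i
  simp only [prismWall, AffineSubspace.direction_mk', Submodule.mem_sup,
    Submodule.mem_span_singleton, mem_prismAxis_base]
  set d := F.base.points (i + 2) - F.base.points (i + 1)
  constructor
  · rintro ⟨_, ⟨a, rfl⟩, u, ⟨c, hc⟩, rfl⟩
    simp only [map_add, map_smul, Pi.add_apply, Pi.smul_apply, hc, hd, if_neg (hi i).1,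
      if_neg (hi i).2]
  · intro h
    refine ⟨_, ⟨F.basis.equivFun v (i + 1) - F.basis.equivFun v i, rfl⟩, _,
      ⟨(F.basis.equivFun v (i + 1) + 2 * F.basis.equivFun v i) / 3, fun j => ?_⟩,
      add_sub_cancel _ v⟩
    have hj : j = i ∨ j = i + 1 ∨ j = i + 2 := by clear * - i j; decide +revert
    simp only [map_sub, map_smul, Pi.sub_apply, Pi.smul_apply, hd, smul_eq_mul]
    obtain rfl | rfl | rfl := hj
    · rw [if_neg (hi j).1]; ring
    · rw [if_pos rfl]; ring
    · rw [if_neg (hi i).2, ← h]; ring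

theorem mem_prismWall_base {i : Fin 3} {x : E3} :
    x ∈ prismWall F.base i ↔ F.chart x i - F.chart x (i + 2) = (if i = 0 then 1 else 0 : ℤ) := by
  have hp : F.chart (F.base.points (i + 1)) i - F.chart (F.base.points (i + 1)) (i + 2)
      = (if i = 0 then 1 else 0 : ℤ) := by
    rw [chart_base]
    fin_cases i
    · simp; norm_num
    · simp
    · simp
  have hmem : x ∈ prismWall F.base i ↔
      x - F.base.points (i + 1) ∈ (prismWall F.base i).direction := by
    rw [prismWall, AffineSubspace.mem_mk', AffineSubspace.direction_mk', vsub_eq_sub]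
  rw [hmem, mem_direction_prismWall_base, ← F.chart_sub, Pi.sub_apply, Pi.sub_apply, ← hp]
  constructor <;> intro h <;> linarith

theorem prismMirror_base_mem_group (i : Fin 3) : prismMirror F.base i ∈ F.group :=
  F.reflection_mem_group (i := i) (j := i + 2) (by decide +revert) fun _ => F.mem_prismWall_base

end Prism

end SymmetricFrame

namespace SymmetricFrame

section Half

variable {E : Type*} [NormedAddCommGroup E] [InnerProductSpace ℝ E] {k : ℕ}
  (F : SymmetricFrame (Fin (k + 1)) E)

/-- The affine functional `1 - x₀ - x_k`, whose zero locus cuts the order simplex into two halves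
that are exchanged by `F.halfTurn`. -/
noncomputable def cut : E →ᵃ[ℝ] ℝ :=
  AffineMap.const ℝ E (1 : ℝ) - F.coord 0 - F.coord (Fin.last k)

theorem cut_apply (x : E) : F.cut x = 1 - F.chart x 0 - F.chart x (Fin.last k) := rfl

theorem cut_linear_ne_zero : F.cut.linear ≠ 0 :=
  linear_ne_zero_of_apply_ne (x := F.chart.symm 1) (y := F.chart.symm 0)
    (by simp only [cut_apply, F.chart.apply_symm_apply, Pi.one_apply, Pi.zero_apply]; norm_num)

/-- The half of the order simplex on which `F.cut` has the sign `ε`. -/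
def half (ε : ℤˣ) : Set E :=
  F.simplex ∩ {x | 0 ≤ ((ε : ℤ) : ℝ) * F.cut x}

variable {F}

theorem exists_sign_mul_cut_nonneg {g : E ≃ᵃⁱ[ℝ] E} (hg : g ∈ F.group) (ε : ℤˣ) :
    ∃ δ : ℤˣ, ∀ x ∈ g '' F.half ε ∩ F.simplex, 0 ≤ ((δ : ℤ) : ℝ) * F.cut x := by
  obtain ⟨n, σ, hσ⟩ := hg
  simp only [cut_apply]
  by_cases hpos : ∃ i, 1 ≤ n i
  · obtain ⟨i, hi⟩ := hpos
    refine ⟨-1, ?_⟩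
    rintro _ ⟨⟨y, hy, rfl⟩, hx⟩
    have hi : (1 : ℝ) ≤ n i := mod_cast hi
    have h0 := hx.1 (Fin.zero_le i)
    rw [hσ] at h0
    push_cast
    linarith [(hy.1.2 (σ i)).1, (hx.2 (Fin.last k)).1]
  by_cases hneg : ∃ i, n i ≤ -1
  · obtain ⟨i, hi⟩ := hneg
    refine ⟨1, ?_⟩
    rintro _ ⟨⟨y, hy, rfl⟩, hx⟩
    have hi : (n i : ℝ) ≤ -1 := mod_cast hi
    have hlast := hx.1 (Fin.le_last i)
    rw [hσ y i] at hlast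
    push_cast
    linarith [(hy.1.2 (σ i)).2, (hx.2 0).2]
  · refine ⟨ε, ?_⟩
    rintro _ ⟨⟨y, hy, rfl⟩, hx⟩
    push Not at hpos hneg
    have hn (i) : n i = 0 := by have := hpos i; have := hneg i; lia
    have hperm : F.chart (g y) = F.chart y ∘ σ := by
      ext i
      rw [hσ, hn, Int.cast_zero, zero_add, Function.comp_apply]
    have hfix : F.chart (g y) = F.chart y :=
      hperm.trans (Tuple.unique_antitone (τ := 1) (hperm ▸ hx.1) hy.1.1)
    rw [hfix]
    exact hy.2

theorem meetsProperly_half {g : E ≃ᵃⁱ[ℝ] E} (hg : g ∈ F.group) (ε ε' : ℤˣ) :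
    MeetsProperly (g '' F.half ε) (F.half ε') := by
  have hsimplex : MeetsProperly (g '' F.half ε) F.simplex :=
    (meetsProperly_simplex hg).mono_left (image_mono inter_subset_left)
  obtain ⟨δ, hδ⟩ := exists_sign_mul_cut_nonneg hg ε
  obtain rfl | hne := eq_or_ne δ ε'
  · exact hsimplex.inter_of_subset hδ
  · rw [Int.units_ne_iff_eq_neg] at hne
    subst hne
    refine hsimplex.inter_halfSpace (f := ((ε' : ℤ) : ℝ) • F.cut) ?_ fun x hx => ?_
    · rw [AffineMap.smul_linear]
      exact smul_ne_zero (Int.cast_ne_zero.2 ε'.ne_zero) F.cut_linear_ne_zero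
    · simpa using hδ x hx

variable (F)

theorem iUnion_half : ⋃ ε, F.half ε = F.simplex := by
  refine (iUnion_subset fun _ => inter_subset_left).antisymm fun x hx => ?_
  obtain h | h := le_total 0 (F.cut x)
  · exact mem_iUnion.2 ⟨1, hx, by simpa using h⟩
  · exact mem_iUnion.2 ⟨-1, hx, by simpa using h⟩

theorem exists_halfTurn :
    ∃ g : E ≃ᵃⁱ[ℝ] E, ∀ x i, F.chart (g x) i = 1 + -1 * F.chart x (Fin.revPerm i) :=
  F.exists_isometry (by norm_num) 1 Fin.revPerm

/-- The symmetry `xᵢ ↦ 1 - x_{k-i}` of the order simplex. It reverses the path of edges whose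
vectors are the basis of the frame, and in dimension three it is a rotation by `π`. -/
noncomputable def halfTurn : E ≃ᵃⁱ[ℝ] E := F.exists_halfTurn.choose

theorem chart_halfTurn (x : E) (i : Fin (k + 1)) :
    F.chart (F.halfTurn x) i = 1 - F.chart x i.rev := by
  rw [halfTurn, F.exists_halfTurn.choose_spec, Fin.revPerm_apply]
  ring

theorem halfTurn_halfTurn (x : E) : F.halfTurn (F.halfTurn x) = x :=
  F.chart_ext fun i => by simp only [chart_halfTurn, Fin.rev_rev, sub_sub_cancel]

theorem halfTurn_mem_simplex {x : E} (hx : x ∈ F.simplex) : F.halfTurn x ∈ F.simplex := by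
  refine ⟨fun i j hij => ?_, fun i => ?_⟩ <;> simp only [chart_halfTurn]
  · linarith [hx.1 (Fin.rev_le_rev.2 hij)]
  · constructor <;> linarith [(hx.2 i.rev).1, (hx.2 i.rev).2]

theorem cut_halfTurn (x : E) : F.cut (F.halfTurn x) = -F.cut x := by
  simp only [cut_apply, chart_halfTurn, Fin.rev_zero, Fin.rev_last]
  ring

theorem halfTurn_mem_half {ε : ℤˣ} {x : E} (hx : x ∈ F.half ε) : F.halfTurn x ∈ F.half (-ε) := by
  refine ⟨F.halfTurn_mem_simplex hx.1, ?_⟩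
  simpa [cut_halfTurn] using hx.2

theorem image_halfTurn_half (ε : ℤˣ) : F.halfTurn '' F.half ε = F.half (-ε) := by
  refine (image_subset_iff.2 fun x hx => F.halfTurn_mem_half hx).antisymm fun x hx => ?_
  exact ⟨F.halfTurn x, neg_neg ε ▸ F.halfTurn_mem_half hx, F.halfTurn_halfTurn x⟩

end Half

section Vertices

variable {E : Type*} [NormedAddCommGroup E] [InnerProductSpace ℝ E]
  (F : SymmetricFrame (Fin 3) E)

theorem mem_simplex {x : E} : x ∈ F.simplex ↔ 0 ≤ F.chart x 2 ∧ F.chart x 2 ≤ F.chart x 1 ∧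
    F.chart x 1 ≤ F.chart x 0 ∧ F.chart x 0 ≤ 1 := by
  rw [simplex, mem_ofPred_eq, Fin.antitone_iff_succ_le, Fin.forall_fin_two]
  refine ⟨fun h => ⟨(h.2 2).1, h.1.2, h.1.1, (h.2 0).2⟩, ?_⟩
  rintro ⟨h2, h21, h10, h0⟩
  refine ⟨⟨h10, h21⟩, fun i => ?_⟩
  fin_cases i <;> simp only [Fin.zero_eta, Fin.mk_one, Fin.reduceFinMk, mem_Icc] <;>
    constructor <;> linarith

theorem convex_simplex : Convex ℝ F.simplex := by
  intro x hx y hy s t hs ht hst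
  rw [mem_simplex] at hx hy ⊢
  simp only [F.chart_combo hst]
  refine ⟨?_, ?_, ?_, ?_⟩ <;> nlinarith

theorem mem_half {ε : ℤˣ} {x : E} : x ∈ F.half ε ↔
    x ∈ F.simplex ∧ 0 ≤ ((ε : ℤ) : ℝ) * (1 - F.chart x 0 - F.chart x 2) := Iff.rfl

theorem convex_half (ε : ℤˣ) : Convex ℝ (F.half ε) :=
  F.convex_simplex.inter <|
    (convex_Ici (0 : ℝ)).affine_preimage (((ε : ℤ) : ℝ) • F.cut : E →ᵃ[ℝ] ℝ)

/-- The vertices `0`, `e₀`, `e₀ + e₁`, `e₀ + e₁ + e₂` of the order simplex. -/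
noncomputable def vertex (k : Fin 4) : E :=
  F.chart.symm (![![0, 0, 0], ![1, 0, 0], ![1, 1, 0], ![1, 1, 1]] k)

theorem chart_vertex (k : Fin 4) :
    F.chart (F.vertex k) = ![![0, 0, 0], ![1, 0, 0], ![1, 1, 0], ![1, 1, 1]] k := by
  rw [vertex, AffineEquiv.apply_symm_apply]

theorem vertex_mem_simplex (k : Fin 4) : F.vertex k ∈ F.simplex := by
  rw [mem_simplex, chart_vertex]
  fin_cases k <;> simp

theorem convexHull_range_eq {κ : Type*} [Fintype κ] {p : κ → E} {K : Set E} (hK : Convex ℝ K)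
    (hp : ∀ j, p j ∈ K) (h : ∀ x ∈ K, ∃ w : κ → ℝ, (∀ j, 0 ≤ w j) ∧ ∑ j, w j = 1 ∧
      ∀ i, F.chart x i = ∑ j, w j * F.chart (p j) i) :
    convexHull ℝ (range p) = K := by
  refine (convexHull_min (range_subset_iff.2 hp) hK).antisymm fun x hx => ?_
  obtain ⟨w, hw0, hw1, hw⟩ := h x hx
  rw [F.chart_ext fun i => (hw i).trans (F.chart_sum hw1 p i).symm]
  exact (convex_convexHull ℝ _).sum_mem (fun j _ => hw0 j) hw1
    fun j _ => subset_convexHull ℝ _ (mem_range_self j)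

theorem convexHull_vertex : convexHull ℝ (range F.vertex) = F.simplex := by
  refine F.convexHull_range_eq F.convex_simplex F.vertex_mem_simplex fun x hx => ?_
  obtain ⟨h2, h21, h10, h0⟩ := F.mem_simplex.1 hx
  refine ⟨![1 - F.chart x 0, F.chart x 0 - F.chart x 1, F.chart x 1 - F.chart x 2, F.chart x 2],
    fun j => ?_, ?_, fun i => ?_⟩
  · fin_cases j <;> simp <;> linarith
  · simp [Fin.sum_univ_four]
  · simp only [Fin.sum_univ_four, F.chart_vertex]
    fin_cases i <;> simp

theorem convexHull_half {p : Fin 4 → E} (hp : ∀ k ≠ 3, p k = F.vertex k)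
    (h3 : p 3 = midpoint ℝ (F.vertex 0) (F.vertex 3)) :
    convexHull ℝ (range p) = F.half 1 := by
  have hc3 (i) : F.chart (p 3) i = 1 / 2 := by
    rw [h3, ← F.coord_apply, AffineMap.map_midpoint, midpoint_eq_smul_add, coord_apply,
      coord_apply, chart_vertex, chart_vertex]
    fin_cases i <;> simp
  have hc0 : F.chart (p 0) = ![0, 0, 0] := by rw [hp 0 (by decide), chart_vertex]; rfl
  have hc1 : F.chart (p 1) = ![1, 0, 0] := by rw [hp 1 (by decide), chart_vertex]; rfl
  have hc2 : F.chart (p 2) = ![1, 1, 0] := by rw [hp 2 (by decide), chart_vertex]; rfl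
  refine F.convexHull_range_eq (F.convex_half 1) (fun j => ?_) fun x hx => ?_
  · rw [mem_half, mem_simplex]
    fin_cases j
    · simp [hc0]
    · simp [hc1]
    · simp [hc2]
    · simp [hc3]; norm_num
  · obtain ⟨hx, hcut⟩ := F.mem_half.1 hx
    obtain ⟨h2, h21, h10, h0⟩ := F.mem_simplex.1 hx
    rw [Units.val_one, Int.cast_one, one_mul] at hcut
    refine ⟨![1 - F.chart x 0 - F.chart x 2, F.chart x 0 - F.chart x 1,
      F.chart x 1 - F.chart x 2, 2 * F.chart x 2], fun j => ?_, ?_, fun i => ?_⟩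
    · fin_cases j <;> simp <;> linarith
    · simp [Fin.sum_univ_four]; ring
    · simp only [Fin.sum_univ_four, hc0, hc1, hc2, hc3]
      fin_cases i <;> simp <;> ring

theorem halfTurn_vertex (k : Fin 4) : F.halfTurn (F.vertex k) = F.vertex k.rev :=
  F.chart_ext fun i => by
    rw [chart_halfTurn, chart_vertex, chart_vertex]
    fin_cases k <;> fin_cases i <;> simp [Fin.rev]

end Vertices

end SymmetricFrame

namespace SymmetricFrame

variable (F : SymmetricFrame (Fin 3) E3)

theorem isDirectIsometry_halfTurn : IsDirectIsometry F.halfTurn := by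
  have hrev : Equiv.Perm.sign (Fin.revPerm : Equiv.Perm (Fin 3)) = -1 := by decide
  rw [halfTurn, isDirectIsometry_iff, F.linearDet_eq F.exists_halfTurn.choose_spec, hrev]
  norm_num

theorem directlyCongruent_half (ε : ℤˣ) : DirectlyCongruent (F.half 1) (F.half ε) := by
  obtain rfl | rfl := Int.units_eq_one_or ε
  · exact ⟨1, .one, one_image _⟩
  · exact ⟨F.halfTurn, F.isDirectIsometry_halfTurn, F.image_halfTurn_half 1⟩

theorem exists_screw : ∃ r ∈ F.group, IsDirectIsometry r ∧
    ∀ x, F.chart (r x) = ![F.chart x 2 + 1, F.chart x 0, F.chart x 1] := by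
  obtain ⟨r, hr, hrx⟩ := F.exists_mem_group ![1, 0, 0] (finRotate 3).symm
  refine ⟨r, hr, ?_, fun x => ?_⟩
  · rw [isDirectIsometry_iff, F.linearDet_eq (ε := 1) fun x i => by rw [hrx, one_mul],
      Equiv.Perm.sign_symm, sign_finRotate]
    norm_num
  · have hσ : ⇑(finRotate 3).symm = ![2, 0, 1] := by decide
    ext i
    rw [hrx, hσ]
    fin_cases i <;> simp [add_comm]

/-- The screw motion `(x₀, x₁, x₂) ↦ (x₂ + 1, x₀, x₁)`. Its powers move the order simplex along the
column. -/
noncomputable def screw : E3 ≃ᵃⁱ[ℝ] E3 := F.exists_screw.choose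

theorem screw_mem_group : F.screw ∈ F.group := F.exists_screw.choose_spec.1

theorem isDirectIsometry_screw : IsDirectIsometry F.screw := F.exists_screw.choose_spec.2.1

theorem chart_screw (x : E3) :
    F.chart (F.screw x) = ![F.chart x 2 + 1, F.chart x 0, F.chart x 1] :=
  F.exists_screw.choose_spec.2.2 x

theorem screw_mem_column {x : E3} : F.screw x ∈ F.column ↔ x ∈ F.column := by
  simp only [mem_column, chart_screw, Matrix.cons_val, add_le_add_iff_right]
  tauto

theorem zpow_screw_mem_column (n : ℤ) {x : E3} : (F.screw ^ n) x ∈ F.column ↔ x ∈ F.column := by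
  induction n with
  | zero => rfl
  | succ n ih =>
    rw [← ih, add_comm, zpow_one_add]
    exact F.screw_mem_column
  | pred n ih =>
    rw [← ih, ← F.screw_mem_column, ← Function.comp_apply (f := F.screw),
      ← AffineIsometryEquiv.coe_mul, ← zpow_one_add, add_sub_cancel]

theorem sum_chart_zpow_screw (n : ℤ) (x : E3) :
    ∑ i, F.chart ((F.screw ^ n) x) i = ∑ i, F.chart x i + n := by
  have hsucc (y : E3) : ∑ i, F.chart (F.screw y) i = ∑ i, F.chart y i + 1 := by
    simp only [Fin.sum_univ_three, chart_screw, Matrix.cons_val]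
    ring
  have hstep (n : ℤ) : (F.screw ^ (n + 1)) x = F.screw ((F.screw ^ n) x) := by
    rw [add_comm, zpow_one_add, AffineIsometryEquiv.coe_mul, Function.comp_apply]
  induction n with
  | zero => simp
  | succ n ih =>
    rw [hstep, hsucc, ih]
    push_cast
    ring
  | pred n ih =>
    rw [← sub_add_cancel (-n : ℤ) 1, hstep, hsucc] at ih
    push_cast at ih ⊢
    linarith

theorem exists_zpow_screw_mem_simplex {x : E3} (hx : x ∈ F.column) :
    ∃ n : ℤ, (F.screw ^ n) x ∈ F.simplex := by
  have hcol (n : ℤ) := F.mem_column.1 ((F.zpow_screw_mem_column n).2 hx)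
  have hsum (n : ℤ) := F.sum_chart_zpow_screw n x
  simp only [Fin.sum_univ_three] at hsum
  set s := F.chart x 0 + F.chart x 1 + F.chart x 2
  have hbdd (n : ℤ) (hn : F.chart ((F.screw ^ n) x) 0 ≤ 1) : n ≤ ⌈3 - s⌉ :=
    Int.cast_le.1 ((show (n : ℝ) ≤ 3 - s by linarith [hsum n, (hcol n).1, (hcol n).2.1]).trans
      (Int.le_ceil _))
  have hlow : F.chart ((F.screw ^ ⌊1 - s⌋) x) 0 ≤ 1 := by
    linarith [Int.floor_le (1 - s), hsum ⌊1 - s⌋, (hcol ⌊1 - s⌋).1, (hcol ⌊1 - s⌋).2.1,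
      (hcol ⌊1 - s⌋).2.2]
  obtain ⟨n, hn, hmax⟩ := Int.exists_greatest_of_bdd ⟨_, hbdd⟩ ⟨_, hlow⟩
  refine ⟨n, F.mem_simplex.2 ⟨?_, (hcol n).2.1, (hcol n).1, hn⟩⟩
  have hnext : 1 < F.chart ((F.screw ^ (n + 1)) x) 0 :=
    not_le.1 fun h => (lt_add_one n).not_ge (hmax _ h)
  rw [add_comm, zpow_one_add, AffineIsometryEquiv.coe_mul, Function.comp_apply, chart_screw]
    at hnext
  exact ((lt_add_iff_pos_left _).1 hnext).le

variable {F} {κ : Type*} {K : κ → Set E3}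

theorem exists_mem_zpow_screw_image {x : E3} (hK : ⋃ i, K i = F.simplex) (hx : x ∈ F.column) :
    ∃ (n : ℤ) (i : κ), (F.screw ^ n) x ∈ K i := by
  obtain ⟨n, hn⟩ := F.exists_zpow_screw_mem_simplex hx
  rw [← hK] at hn
  exact ⟨n, mem_iUnion.1 hn⟩

theorem sUnion_tilesIn_column (hK : ⋃ i, K i = F.simplex) :
    ⋃₀ tilesIn (orbitTiles F.group K) F.column = F.column := by
  refine (sUnion_subset fun L hL => hL.2).antisymm fun x hx => ?_
  obtain ⟨n, i, hi⟩ := exists_mem_zpow_screw_image hK hx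
  have hinv : ⇑(F.screw ^ n)⁻¹ '' K i ⊆ F.column := by
    rintro _ ⟨y, hy, rfl⟩
    rw [← zpow_neg, zpow_screw_mem_column]
    exact simplex_subset_column (hK ▸ mem_iUnion_of_mem i hy)
  refine ⟨_, ⟨⟨_, F.group.inv_mem (F.group.zpow_mem F.screw_mem_group n), i, rfl⟩, hinv⟩,
    _, hi, ?_⟩
  exact (F.screw ^ n).symm_apply_apply x

theorem directlyCongruent_of_mem_tilesIn_column {T : Tetrahedron} (hK : ⋃ i, K i = F.simplex)
    (hT : ∀ i, DirectlyCongruent T.body (K i))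
    (hmeet : ∀ g ∈ F.group, ∀ i j, MeetsProperly (g '' K i) (K j))
    {L : Set E3} (hL : L ∈ tilesIn (orbitTiles F.group K) F.column) :
    DirectlyCongruent T.body L := by
  obtain ⟨x, hx⟩ : (interior L).Nonempty := by
    obtain ⟨g, -, i, rfl⟩ := hL.1
    exact ((hT i).congruentSets.image_right g).nonempty_interior
  obtain ⟨n, i, hi⟩ := exists_mem_zpow_screw_image hK (hL.2 (interior_subset hx))
  have hM := image_mem_orbitTiles (F.group.zpow_mem F.screw_mem_group n) hL.1
  have hx' : (F.screw ^ n) x ∈ interior ((F.screw ^ n) '' L) :=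
    interior_image_isometry _ L ▸ mem_image_of_mem _ hx
  have heq : (F.screw ^ n) '' L = K i :=
    (meetsProperly_orbitTiles hmeet hM (mem_orbitTiles i)).eq_of_mem_interior
      (meetsProperly_orbitTiles hmeet (mem_orbitTiles i) hM) (hT i).congruentSets.convex
      (hT i).congruentSets.nonempty_interior hx' hi
  exact (hT i).trans (heq ▸ DirectlyCongruent.symm ⟨_, F.isDirectIsometry_screw.zpow n, rfl⟩)

theorem isAlternatingPrismDissection_orbitTiles {T : Tetrahedron} (hK : ⋃ i, K i = F.simplex)
    (hT : ∀ i, DirectlyCongruent T.body (K i))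
    (hmeet : ∀ g ∈ F.group, ∀ i j, MeetsProperly (g '' K i) (K j)) :
    IsAlternatingPrismDissection (orbitTiles F.group K) := by
  have hsub (i : κ) : K i ⊆ F.column :=
    (subset_iUnion K i).trans (hK.trans_subset simplex_subset_column)
  refine ⟨orbitTiles F.group fun _ : Unit => F.column,
    sUnion_orbitTiles_eq_univ fun x => ?_, fun P hP Q hQ =>
      disjoint_interior_orbitTiles (fun g hg _ _ => meetsProperly_column hg) hP hQ, ?_, ?_⟩
  · obtain ⟨g, hg, hx⟩ := F.exists_mem_image_simplex x
    rw [iUnion_const]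
    exact ⟨g, hg, image_mono simplex_subset_column hx⟩
  · rintro _ ⟨g, hg, i, rfl⟩
    exact ⟨_, ⟨g, hg, (), rfl⟩, image_mono (hsub i)⟩
  rintro _ ⟨g, hg, -, rfl⟩
  have htiles := tilesIn_image_orbitTiles (K := K) hg F.column
  refine ⟨?_, ?_, (F.map g).base, (F.map g).equilateral_base, ?_, fun i => ?_⟩
  · rw [htiles]
    exact image_sUnion.symm.trans (congrArg _ (sUnion_tilesIn_column hK))
  · rw [htiles]
    rintro _ ⟨L, hL, rfl⟩ _ ⟨M, hM, rfl⟩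
    exact ((directlyCongruent_of_mem_tilesIn_column hK hT hmeet hL).symm.trans
      (directlyCongruent_of_mem_tilesIn_column hK hT hmeet hM)).image g
  · rw [prism_base, column_map]
  · have hmirror := F.group_map_le hg ((F.map g).prismMirror_base_mem_group i)
    exact ⟨image_mem_orbitTiles hmirror ⟨g, hg, (), rfl⟩, tilesIn_image_orbitTiles hmirror _⟩

end SymmetricFrame

section AffineGeometry

variable {V : Type*} [NormedAddCommGroup V] [InnerProductSpace ℝ V]

theorem inner_sub_sub_eq_dist (p q r s : V) : inner ℝ (q - p) (s - r) =
    (dist p s ^ 2 + dist q r ^ 2 - dist p r ^ 2 - dist q s ^ 2) / 2 := by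
  simp only [dist_eq_norm, norm_sub_sq_real, inner_sub_left, inner_sub_right]
  ring

theorem dist_lineMap_sq (x p q : V) (r : ℝ) : dist x (AffineMap.lineMap p q r) ^ 2 =
    (1 - r) * dist x p ^ 2 + r * dist x q ^ 2 - r * (1 - r) * dist p q ^ 2 := by
  have hx : x - AffineMap.lineMap p q r = (x - p) - r • (q - p) := by
    rw [AffineMap.lineMap_apply_module']
    abel
  rw [dist_comm p q, dist_eq_norm, dist_eq_norm, dist_eq_norm, dist_eq_norm, hx,
    ← sub_sub_sub_cancel_right x q p, norm_sub_sq_real (x - p), norm_sub_sq_real (x - p),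
    inner_smul_right, norm_smul, mul_pow, Real.norm_eq_abs, sq_abs]
  ring

theorem vectorSpan_range_le_span_sub {n : ℕ} (p : Fin (n + 1) → V) :
    vectorSpan ℝ (range p) ≤ Submodule.span ℝ (range fun i : Fin n => p i.succ - p i.castSucc) := by
  rw [vectorSpan_range_eq_span_range_vsub_right ℝ p 0, Submodule.span_le, range_subset_iff]
  intro k
  induction k using Fin.induction with
  | zero => simp
  | succ i ih =>
    have h := add_mem (Submodule.subset_span (mem_range_self i)) ih
    rwa [vsub_eq_sub, sub_add_sub_cancel] at h

theorem linearIndependent_smul_add_smul_sum {ι : Type*} [Fintype ι] {v : ι → V}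
    (hv : LinearIndependent ℝ v) {s t : ℝ} (hs : s ≠ 0) (hst : s + Fintype.card ι * t ≠ 0) :
    LinearIndependent ℝ fun i => s • v i + t • ∑ j, v j := by
  rw [Fintype.linearIndependent_iff] at hv ⊢
  intro c hc
  have hcoeff := hv (fun j => s * c j + t * ∑ i, c i) <| by
    rw [← hc]
    simp only [add_smul, smul_add, smul_smul, Finset.sum_add_distrib, ← Finset.smul_sum,
      ← Finset.sum_smul, Finset.mul_sum, mul_comm]
  have hsum : (s + Fintype.card ι * t) * ∑ i, c i = 0 := by
    have := Finset.sum_eq_zero fun j (_ : j ∈ Finset.univ) => hcoeff j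
    simp only [Finset.sum_add_distrib, ← Finset.mul_sum, Finset.sum_const, Finset.card_univ,
      nsmul_eq_mul] at this
    linear_combination this
  rw [mul_eq_zero_iff_left hst] at hsum
  simpa only [hsum, mul_zero, add_zero, mul_eq_zero_iff_left hs] using hcoeff

theorem inner_smul_add_smul_sum_of_orthonormal {ι : Type*} [Fintype ι] [DecidableEq ι] {v : ι → V}
    (hv : Orthonormal ℝ v) (s t : ℝ) (i j : ι) :
    inner ℝ (s • v i + t • ∑ k, v k) (s • v j + t • ∑ k, v k)
      = (if i = j then s ^ 2 else 0) + (2 * s * t + Fintype.card ι * t ^ 2) := by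
  simp only [inner_add_left, inner_add_right, inner_smul_left, inner_smul_right, sum_inner,
    inner_sum, orthonormal_iff_ite.1 hv, Finset.sum_ite_eq, Finset.sum_ite_eq', Finset.mem_univ,
    if_true, Finset.sum_const, Finset.card_univ, nsmul_eq_mul, conj_trivial, mul_add,
    Finset.sum_add_distrib, ← Finset.mul_sum]
  split_ifs <;> ring

end AffineGeometry

namespace SymmetricFrame

theorem exists_sq_eq_prod_eq (ι : Type*) [Fintype ι] [Nonempty ι] {p q : ℝ} (hpq : p < q)
    (hpos : 0 < q - p + Fintype.card ι * p) :
    ∃ F : SymmetricFrame ι (EuclideanSpace ℝ ι), F.sq = q ∧ F.prod = p := by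
  classical
  have hn : (Fintype.card ι : ℝ) ≠ 0 := Nat.cast_ne_zero.2 Fintype.card_ne_zero
  obtain ⟨s, hs, hs2⟩ : ∃ s : ℝ, s ≠ 0 ∧ s ^ 2 = q - p :=
    ⟨√(q - p), (Real.sqrt_pos.2 (sub_pos.2 hpq)).ne', Real.sq_sqrt (sub_pos.2 hpq).le⟩
  obtain ⟨m, hm, hm2⟩ : ∃ m : ℝ, m ≠ 0 ∧ m ^ 2 = q - p + Fintype.card ι * p :=
    ⟨√(q - p + Fintype.card ι * p), (Real.sqrt_pos.2 hpos).ne', Real.sq_sqrt hpos.le⟩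
  obtain ⟨t, rfl⟩ : ∃ t, m = s + Fintype.card ι * t :=
    ⟨(m - s) / Fintype.card ι, by field_simp; ring⟩
  have hp : 2 * s * t + Fintype.card ι * t ^ 2 = p :=
    mul_left_cancel₀ hn (by linear_combination hm2 - hs2)
  have hu := (EuclideanSpace.basisFun ι ℝ).orthonormal
  have hinner := inner_smul_add_smul_sum_of_orthonormal hu s t
  simp only [hs2, hp] at hinner
  refine ⟨⟨0, basisOfLinearIndependentOfCardEqFinrank
    (linearIndependent_smul_add_smul_sum hu.linearIndependent hs hm) (by simp), q, p,
    fun i => ?_, fun i j hij => ?_⟩, rfl, rfl⟩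
  · rw [coe_basisOfLinearIndependentOfCardEqFinrank, hinner, if_pos rfl, sub_add_cancel]
  · rw [coe_basisOfLinearIndependentOfCardEqFinrank, hinner, if_neg hij, zero_add]

variable (F : SymmetricFrame (Fin 3) E3)

theorem vertex_zero : F.vertex 0 = F.origin :=
  F.chart_ext fun i => by
    rw [chart_vertex, chart_apply, sub_self, map_zero]
    fin_cases i <;> rfl

theorem vertex_succ (i : Fin 3) : F.vertex i.succ = F.basis i + F.vertex i.castSucc := by
  refine sub_eq_iff_eq_add.1 (F.basis.equivFun.injective ?_)
  rw [← chart_sub, chart_vertex, chart_vertex, Module.Basis.equivFun_apply, Module.Basis.repr_self]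
  ext j
  fin_cases i <;> fin_cases j <;> simp

theorem dist_vertex_sq (i j : Fin 4) : dist (F.vertex i) (F.vertex j) ^ 2
    = (F.sq - F.prod) * |(i : ℝ) - j| + F.prod * ((i : ℝ) - j) ^ 2 := by
  rw [F.dist_sq_eq, chart_vertex, chart_vertex, Fin.sum_univ_three, Fin.sum_univ_three]
  fin_cases i <;> fin_cases j <;> simp <;> norm_num

theorem affineIndependent_vertex : AffineIndependent ℝ F.vertex := by
  refine F.affineIndependent_of_chart fun w hw h => ?_
  have h0 := h 0
  have h1 := h 1
  have h2 := h 2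
  simp only [chart_vertex, Fin.sum_univ_four] at hw h0 h1 h2
  simp only [Fin.isValue, Nat.succ_eq_add_one, Nat.reduceAdd, Matrix.cons_val',
    Matrix.cons_val_zero, Matrix.cons_val_fin_one, mul_zero, Matrix.cons_val_one, mul_one, zero_add,
    Matrix.cons_val, add_zero] at h0 h1 h2
  intro j
  fin_cases j <;> simp only [Fin.zero_eta, Fin.mk_one, Fin.reduceFinMk] <;> linarith

/-- The tetrahedron whose edge path `V₁V₂V₃V₄` has the basis of the frame as its edge vectors. -/
noncomputable def tetrahedron : Tetrahedron := ⟨F.vertex, F.affineIndependent_vertex⟩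

end SymmetricFrame

namespace Tetrahedron

/-- The tetrahedron `T` with its edge `V₁V₄` stretched by the factor `r`, keeping `V₁` fixed. -/
noncomputable def stretch (T : Tetrahedron) (r : ℝˣ) : Tetrahedron where
  points := fun i : Fin 4 =>
    AffineMap.lineMap (T.points 0) (T.points i) (Function.update (1 : Fin 4 → ℝˣ) 3 r i : ℝ)
  independent := T.independent.units_lineMap 0 (Function.update (1 : Fin 4 → ℝˣ) 3 r)

variable (T : Tetrahedron) (r : ℝˣ)

theorem points_stretch_of_ne {i : Fin 4} (hi : i ≠ 3) : (T.stretch r).points i = T.points i := by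
  simp [stretch, hi]

theorem points_stretch_three :
    (T.stretch r).points 3 = AffineMap.lineMap (T.points 0) (T.points 3) (r : ℝ) := by
  simp [stretch]

theorem len_stretch_of_ne {i j : Fin 4} (hi : i ≠ 3) (hj : j ≠ 3) :
    (T.stretch r).len i j = T.len i j := by
  rw [len, len, points_stretch_of_ne T r hi, points_stretch_of_ne T r hj]

theorem len_stretch_zero_three : (T.stretch r).len 0 3 = |(r : ℝ)| * T.len 0 3 := by
  rw [len, points_stretch_of_ne T r (by decide), points_stretch_three, dist_left_lineMap,
    Real.norm_eq_abs, len]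

theorem len_stretch_sq {i : Fin 4} (hi : i ≠ 3) : (T.stretch r).len i 3 ^ 2 =
    (1 - r) * T.len i 0 ^ 2 + r * T.len i 3 ^ 2 - r * (1 - r) * T.len 0 3 ^ 2 := by
  simp only [len, points_stretch_of_ne T r hi, points_stretch_three, dist_lineMap_sq]

variable {T} {a b c d : ℝ}

theorem len_comm (i j : Fin 4) : T.len i j = T.len j i := dist_comm _ _

theorem len_self (i : Fin 4) : T.len i i = 0 := dist_self _

theorem len_nonneg (i j : Fin 4) : 0 ≤ T.len i j := dist_nonneg

theorem len_eq_of_sq_eq {i j : Fin 4} {x : ℝ} (hx : 0 ≤ x) (h : T.len i j ^ 2 = x ^ 2) :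
    T.len i j = x :=
  (pow_left_inj₀ (len_nonneg i j) hx two_ne_zero).1 h

theorem exists_isGoldbergFirst (ha : 0 < a) (hab : a < 3 * b) :
    ∃ (c : ℝ) (T : Tetrahedron), T.IsGoldbergFirst a b c := by
  obtain ⟨F, hq, hp⟩ := SymmetricFrame.exists_sq_eq_prod_eq (Fin 3)
    (p := (a ^ 2 - 3 * b ^ 2) / 6) (q := b ^ 2) (by nlinarith)
    (by rw [Fintype.card_fin]; push_cast; nlinarith)
  have hb : 0 < b := by linarith
  have hlen (i j : Fin 4) : F.tetrahedron.len i j ^ 2 = _ := F.dist_vertex_sq i j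
  rw [hq, hp] at hlen
  refine ⟨F.tetrahedron.len 0 2, F.tetrahedron, ?_, ?_, rfl, ?_, ?_, ?_, ?_⟩
  · rw [hlen]
    norm_num
    ring
  all_goals
    refine len_eq_of_sq_eq (by first | exact len_nonneg 0 2 | linarith) ?_
    simp only [hlen]
    norm_num
  all_goals ring

theorem IsGoldbergFirst.stretch_half (hT : T.IsGoldbergFirst a b c) {r : ℝˣ}
    (hr : (r : ℝ) = 1 / 2) :
    (T.stretch r).IsGoldbergSecond a b c ((T.stretch r).len 1 3) := by
  obtain ⟨hrel, h01, h02, h03, h12, h13, h23⟩ := hT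
  have h13' := T.len_stretch_sq r (i := 1) (by decide)
  have h23' := T.len_stretch_sq r (i := 2) (by decide)
  rw [len_comm 1 0, h01, h03, h13, hr] at h13'
  rw [len_comm 2 0, h02, h03, h23, hr] at h23'
  exact {
    rel₁ := by rw [h13']; linarith
    rel₂ := hrel
    len12 := by rw [len_stretch_of_ne _ _ (by decide) (by decide), h01]
    len13 := by rw [len_stretch_of_ne _ _ (by decide) (by decide), h02]
    len14 := by rw [len_stretch_zero_three, h03, hr, abs_of_pos one_half_pos]; ring
    len23 := by rw [len_stretch_of_ne _ _ (by decide) (by decide), h12]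
    len24 := rfl
    len34 := len_eq_of_sq_eq (len_nonneg 1 3) (by rw [h13', h23']; linarith) }

theorem IsGoldbergSecond.stretch_two (hT : T.IsGoldbergSecond a b c d) {r : ℝˣ} (hr : (r : ℝ) = 2) :
    (T.stretch r).IsGoldbergFirst a b c := by
  obtain ⟨hrel₁, hrel₂, h01, h02, h03, h12, h13, h23⟩ := hT
  have h13' := T.len_stretch_sq r (i := 1) (by decide)
  have h23' := T.len_stretch_sq r (i := 2) (by decide)
  rw [len_comm 1 0, h01, h03, h13, hr] at h13'
  rw [len_comm 2 0, h02, h03, h23, hr] at h23'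
  exact {
    rel := hrel₂
    len12 := by rw [len_stretch_of_ne _ _ (by decide) (by decide), h01]
    len13 := by rw [len_stretch_of_ne _ _ (by decide) (by decide), h02]
    len14 := by rw [len_stretch_zero_three, h03, hr, abs_of_pos two_pos]; ring
    len23 := by rw [len_stretch_of_ne _ _ (by decide) (by decide), h12]
    len24 := len_eq_of_sq_eq (h02 ▸ len_nonneg 0 2) (by rw [h13']; linarith)
    len34 := len_eq_of_sq_eq (h01 ▸ len_nonneg 0 1) (by rw [h23']; linarith) }

theorem IsGoldbergFirst.len_sq (hT : T.IsGoldbergFirst a b c) (i j : Fin 4) : T.len i j ^ 2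
    = (2 * b ^ 2 - c ^ 2 / 2) * |(i : ℝ) - j| + (c ^ 2 / 2 - b ^ 2) * ((i : ℝ) - j) ^ 2 := by
  obtain ⟨hrel, h01, h02, h03, h12, h13, h23⟩ := hT
  wlog hij : i ≤ j generalizing i j
  · rw [len_comm, this j i (le_of_not_ge hij), abs_sub_comm, ← neg_sub (i : ℝ), neg_sq]
  fin_cases i <;> fin_cases j <;> simp only [Fin.zero_eta, Fin.mk_one, Fin.reduceFinMk] at hij ⊢
  all_goals first
  | exact absurd hij (by decide)
  | simp only [len_self, h01, h02, h03, h12, h13, h23]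
    norm_num
    try linarith

theorem IsGoldbergFirst.exists_frame (hT : T.IsGoldbergFirst a b c) :
    ∃ F : SymmetricFrame (Fin 3) E3, F.vertex = T.points := by
  let e (i : Fin 3) : E3 := T.points i.succ - T.points i.castSucc
  have hspan : ⊤ ≤ Submodule.span ℝ (range e) := by
    have h := T.independent.vectorSpan_eq_top_of_card_eq_finrank_add_one (by simp)
    exact h.ge.trans (vectorSpan_range_le_span_sub T.points)
  have hinner (i j : Fin 3) : inner ℝ (e i) (e j) =
      if i = j then b ^ 2 else c ^ 2 / 2 - b ^ 2 := by
    have hlen (k l : Fin 4) : dist (T.points k) (T.points l) ^ 2 = _ := hT.len_sq k l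
    simp only [e, inner_sub_sub_eq_dist, hlen]
    fin_cases i <;> fin_cases j <;> norm_num <;> ring
  have hcard : Fintype.card (Fin 3) = Module.finrank ℝ E3 := by simp
  let F : SymmetricFrame (Fin 3) E3 :=
    { origin := T.points 0
      basis := basisOfTopLeSpanOfCardEqFinrank e hspan hcard
      sq := b ^ 2
      prod := c ^ 2 / 2 - b ^ 2
      inner_self := fun i => by
        rw [coe_basisOfTopLeSpanOfCardEqFinrank, hinner, if_pos rfl]
      inner_of_ne := fun i j hij => by
        rw [coe_basisOfTopLeSpanOfCardEqFinrank, hinner, if_neg hij] }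
  refine ⟨F, funext fun k => ?_⟩
  induction k using Fin.induction with
  | zero => exact F.vertex_zero
  | succ i ih =>
    have hbasis : F.basis i = e i := by simp [F]
    rw [F.vertex_succ, ih, hbasis, sub_add_cancel]

end Tetrahedron

theorem SymmetricFrame.exists_tiling (F : SymmetricFrame (Fin 3) E3) {T : Tetrahedron} {κ : Type*}
    {K : κ → Set E3} (hK : ⋃ i, K i = F.simplex) (hT : ∀ i, DirectlyCongruent T.body (K i))
    (hmeet : ∀ g ∈ F.group, ∀ i j, MeetsProperly (g '' K i) (K j)) :
    ∃ 𝒯, IsFaceToFaceTiling T 𝒯 ∧ IsAlternatingPrismDissection 𝒯 :=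
  ⟨orbitTiles F.group K,
    isFaceToFaceTiling_orbitTiles (fun i => (hT i).congruentSets)
      (fun x => hK ▸ F.exists_mem_image_simplex x) hmeet,
    F.isAlternatingPrismDissection_orbitTiles hK hT hmeet⟩

namespace Tetrahedron

variable {T : Tetrahedron} {a b c d : ℝ}

theorem exists_isGoldbergSecond (ha : 0 < a) (hab : a < 3 * b) :
    ∃ (c d : ℝ) (T : Tetrahedron), T.IsGoldbergSecond a b c d := by
  obtain ⟨c, T, hT⟩ := exists_isGoldbergFirst ha hab
  exact ⟨c, _, _, hT.stretch_half (r := Units.mk0 (1 / 2) (by norm_num)) rfl⟩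

theorem IsGoldbergFirst.exists_tiling (hT : T.IsGoldbergFirst a b c) :
    ∃ 𝒯, IsFaceToFaceTiling T 𝒯 ∧ IsAlternatingPrismDissection 𝒯 := by
  obtain ⟨F, hF⟩ := hT.exists_frame
  have hbody : T.body = F.simplex := by rw [body, ← hF, F.convexHull_vertex]
  exact F.exists_tiling (K := fun _ : Unit => F.simplex) (iUnion_const _)
    (fun _ => ⟨1, .one, hbody ▸ one_image _⟩)
    (fun g hg _ _ => SymmetricFrame.meetsProperly_simplex hg)

theorem IsGoldbergSecond.exists_tiling (hT : T.IsGoldbergSecond a b c d) :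
    ∃ 𝒯, IsFaceToFaceTiling T 𝒯 ∧ IsAlternatingPrismDissection 𝒯 := by
  let r : ℝˣ := Units.mk0 2 two_ne_zero
  obtain ⟨F, hF⟩ := (hT.stretch_two (r := r) rfl).exists_frame
  have hne (k : Fin 4) (hk : k ≠ 3) : T.points k = F.vertex k := by
    rw [hF, points_stretch_of_ne T r hk]
  have hthree : T.points 3 = midpoint ℝ (F.vertex 0) (F.vertex 3) := by
    rw [← hne 0 (by decide), hF, points_stretch_three, midpoint, AffineMap.lineMap_lineMap_right]
    simp [r]
  have hbody : T.body = F.half 1 := F.convexHull_half hne hthree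
  exact F.exists_tiling F.iUnion_half (fun ε => hbody ▸ F.directlyCongruent_half ε)
    (fun g hg => SymmetricFrame.meetsProperly_half hg)

end Tetrahedron

section Packing

variable {E : Type*} [NormedAddCommGroup E] [NormedSpace ℝ E] [FiniteDimensional ℝ E]

theorem finite_of_pairwise_disjoint_ball {ι : Type*} {x : ι → E} {r : ℝ} (hr : 0 < r)
    (hx : Bornology.IsBounded (range x))
    (hdisj : Pairwise (Function.onFun Disjoint fun i => Metric.ball (x i) r)) : Finite ι := by
  borelize E
  let μ : MeasureTheory.Measure E := MeasureTheory.Measure.addHaar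
  have hsub : ⋃ i, Metric.ball (x i) r ⊆ Metric.thickening r (range x) :=
    iUnion_subset fun i => Metric.ball_subset_thickening (mem_range_self i) r
  have hfin := μ.finite_const_le_meas_of_disjoint_iUnion (Metric.measure_ball_pos μ 0 hr)
    (fun _ => measurableSet_ball) hdisj
    (ne_top_of_le_ne_top hx.thickening.measure_lt_top.ne (MeasureTheory.measure_mono hsub))
  refine finite_univ_iff.1 (hfin.subset fun i _ => ?_)
  exact (μ.addHaar_ball_center (x i) r).ge

end Packing

namespace IsFaceToFaceTiling

variable {T : Tetrahedron} {𝒯 : Set (Set E3)}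

theorem locallyFinite (h : IsFaceToFaceTiling T 𝒯) : LocallyFinite fun L : 𝒯 => (L : Set E3) := by
  obtain ⟨c, hc⟩ : (interior T.body).Nonempty := CongruentSets.nonempty_interior ⟨1, one_image _⟩
  obtain ⟨r, hr, hball⟩ := Metric.isOpen_iff.1 isOpen_interior c hc
  obtain ⟨R, hR⟩ := ((finite_range T.points).isCompact_convexHull ℝ).isBounded.subset_closedBall c
  choose φ hφ using fun L : 𝒯 => h.congruent L L.2
  have hinner (L : 𝒯) : Metric.ball (φ L c) r ⊆ interior L := by
    conv_rhs => rw [← hφ L, interior_image_isometry]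
    exact ((φ L).toIsometryEquiv.image_ball c r).symm.trans_subset (image_mono hball)
  have houter (L : 𝒯) : (L : Set E3) ⊆ Metric.closedBall (φ L c) R := by
    conv_lhs => rw [← hφ L]
    exact (image_mono hR).trans_eq ((φ L).toIsometryEquiv.image_closedBall c R)
  intro x
  refine ⟨Metric.ball x 1, Metric.ball_mem_nhds x one_pos, ?_⟩
  refine finite_coe_iff.1 <|
    finite_of_pairwise_disjoint_ball (x := fun L => φ L.1 c) hr ?_ fun L M hLM => ?_
  · refine Metric.isBounded_closedBall.subset (range_subset_iff.2 fun L => ?_ :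
      _ ⊆ Metric.closedBall x (R + 1))
    obtain ⟨y, hyL, hyx⟩ := L.2
    have h₁ := Metric.mem_closedBall'.1 (houter L.1 hyL)
    exact Metric.mem_closedBall.2 <| (dist_triangle _ y x).trans (add_le_add h₁ hyx.le)
  · exact (h.disjoint_interior _ L.1.2 _ M.1.2 fun e => hLM (Subtype.ext (Subtype.ext e))).mono
      (hinner L.1) (hinner M.1)

theorem isClosed (h : IsFaceToFaceTiling T 𝒯) {L : Set E3} (hL : L ∈ 𝒯) : IsClosed L := by
  obtain ⟨f, rfl⟩ := h.congruent L hL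
  exact ((finite_range T.points).isClosed_convexHull ℝ |> f.toHomeomorph.isClosed_image.2)

theorem exists_ne_mem (h : IsFaceToFaceTiling T 𝒯) {K : Set E3} {x : E3} (hx : x ∉ interior K) :
    ∃ L ∈ 𝒯, L ≠ K ∧ x ∈ L := by
  by_contra! hno
  have hclosed : IsClosed (⋃ L : {L : 𝒯 // (L : Set E3) ≠ K}, (L : Set E3)) :=
    (h.locallyFinite.comp_injective Subtype.val_injective).isClosed_iUnion
      fun L => h.isClosed L.1.2
  refine hx (mem_interior.2 ⟨_, fun y hy => ?_, hclosed.isOpen_compl, fun hxL => ?_⟩)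
  · obtain ⟨L, hL, hyL⟩ : y ∈ ⋃₀ 𝒯 := h.cover ▸ mem_univ y
    by_contra hyK
    exact hy (mem_iUnion.2 ⟨⟨⟨L, hL⟩, fun hLK => hyK (hLK ▸ hyL)⟩, hyL⟩)
  · obtain ⟨L, hxL⟩ := mem_iUnion.1 hxL
    exact hno L L.1.2 L.2 hxL

end IsFaceToFaceTiling

section Rigidity

open Module

variable {V : Type*} [NormedAddCommGroup V] [InnerProductSpace ℝ V] [FiniteDimensional ℝ V]

theorem eq_one_of_det_pos_of_fixes_hyperplane {A : V ≃ₗᵢ[ℝ] V}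
    (hA : 0 < LinearMap.det (A.toLinearEquiv : V →ₗ[ℝ] V)) {W : Submodule ℝ V}
    (hW : finrank ℝ V ≤ finrank ℝ W + 1) (hfix : ∀ v ∈ W, A v = v) : A = 1 := by
  have hle : W ≤ (ContinuousLinearMap.id ℝ V - A.toContinuousLinearEquiv).ker := fun v hv => by
    simp [hfix v hv]
  have hdim : finrank ℝ (ContinuousLinearMap.id ℝ V - A.toContinuousLinearEquiv).kerᗮ ≤ 1 := by
    have := Submodule.finrank_mono (Submodule.orthogonal_le hle)
    have := W.finrank_add_finrank_orthogonal
    omega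
  obtain ⟨l, hl, rfl⟩ := A.reflections_generate_dim_aux hdim
  obtain _ | ⟨v, l⟩ := l
  · rfl
  obtain rfl : l = [] := List.length_eq_zero_iff.1 (by simpa using hl)
  rw [List.map_cons, List.map_nil, List.prod_singleton] at hA ⊢
  obtain rfl | hv := eq_or_ne v 0
  · exact LinearIsometryEquiv.ext fun x => Submodule.reflection_mem_subspace_eq_self (by simp)
  · change 0 < LinearMap.det (ℝ ∙ v)ᗮ.reflection.toLinearMap at hA
    rw [Submodule.det_reflection, Submodule.orthogonal_orthogonal, finrank_span_singleton hv,
      pow_one] at hA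
    exact absurd hA (by norm_num)

theorem eq_one_of_linearDet_pos_of_fixes {g : V ≃ᵃⁱ[ℝ] V} (hg : 0 < linearDet g) {ι : Type*}
    [Fintype ι] [Nonempty ι] {p : ι → V} (hp : AffineIndependent ℝ p)
    (hcard : finrank ℝ V ≤ Fintype.card ι) (hfix : ∀ i, g (p i) = p i) : g = 1 := by
  have hlin : g.linearIsometryEquiv = 1 := by
    refine eq_one_of_det_pos_of_fixes_hyperplane hg (W := vectorSpan ℝ (range p))
      (hcard.trans (hp.finrank_vectorSpan_add_one).ge) fun v hv => ?_
    induction hv using Submodule.span_induction with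
    | mem v hv =>
      obtain ⟨_, ⟨i, rfl⟩, _, ⟨j, rfl⟩, rfl⟩ := hv
      exact (g.map_vsub _ _).trans (by rw [hfix, hfix])
    | zero => exact map_zero _
    | add v w _ _ hv hw => rw [map_add, hv, hw]
    | smul r v _ hv => rw [map_smul, hv]
  obtain ⟨i⟩ := ‹Nonempty ι›
  refine AffineIsometryEquiv.ext fun x => ?_
  have hx := g.map_vsub x (p i)
  rw [hlin, hfix] at hx
  exact (vsub_left_cancel hx).symm

end Rigidity

theorem mem_extremePoints_convexHull_range {E ι : Type*} [NormedAddCommGroup E] [NormedSpace ℝ E]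
    [Finite ι] {p : ι → E} (hp : AffineIndependent ℝ p) (i : ι) :
    p i ∈ (convexHull ℝ (range p)).extremePoints ℝ := by
  by_contra hi
  have hsub : (convexHull ℝ (range p)).extremePoints ℝ ⊆ p '' (univ \ {i}) := fun x hx => by
    obtain ⟨j, rfl⟩ := extremePoints_convexHull_subset hx
    exact mem_image_of_mem p ⟨mem_univ j, fun hj => hi (hj ▸ hx)⟩
  have hclosure := closure_convexHull_extremePoints
    ((finite_range p).isCompact_convexHull ℝ) (convex_convexHull ℝ (range p))
  rw [((toFinite _).subset hsub).isClosed_convexHull ℝ |>.closure_eq] at hclosure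
  have hmem : p i ∈ convexHull ℝ ((convexHull ℝ (range p)).extremePoints ℝ) :=
    hclosure.ge (subset_convexHull ℝ _ (mem_range_self i))
  exact hp.notMem_affineSpan_sdiff i univ
    (convexHull_subset_affineSpan _ (convexHull_mono hsub hmem))

namespace Tetrahedron

variable (T : Tetrahedron)

/-- The vertices of a tetrahedron as an affine basis of space. -/
noncomputable def affineBasis : AffineBasis (Fin 4) ℝ E3 :=
  ⟨T.points, T.independent,
    T.independent.affineSpan_eq_top_iff_card_eq_finrank_add_one.2 (by simp)⟩

theorem points_mem_body (j : Fin 4) : T.points j ∈ T.body :=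
  subset_convexHull ℝ _ (mem_range_self j)

/-- The image of a tetrahedron under an isometry, its vertices being labelled accordingly. -/
noncomputable def image (g : E3 ≃ᵃⁱ[ℝ] E3) : Tetrahedron :=
  T.map g.toAffineEquiv.toAffineMap g.injective

theorem body_image (g : E3 ≃ᵃⁱ[ℝ] E3) : (T.image g).body = g '' T.body := by
  have himage : g '' T.body = convexHull ℝ (g '' range T.points) :=
    g.toAffineEquiv.toAffineMap.image_convexHull _
  rw [himage, ← range_comp]
  rfl

theorem exists_notMem_interior_body (k : Fin 4) : ∃ x ∈ T.body, x ∉ interior T.body ∧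
    ∀ F, IsExtreme ℝ T.body F → x ∈ F → ∀ m ≠ k, T.points m ∈ F := by
  have hweights : ∑ m ∈ Finset.univ.erase k, (1 / 3 : ℝ) = 1 := by
    rw [Finset.sum_const, Finset.card_erase_of_mem (Finset.mem_univ k), Finset.card_fin]
    norm_num
  refine ⟨∑ m ∈ Finset.univ.erase k, (1 / 3 : ℝ) • T.points m, ?_, fun hint => ?_,
    fun F hF hx m hm => ?_⟩
  · exact (convex_convexHull ℝ _).sum_mem (fun _ _ => by norm_num) hweights
      fun m _ => T.points_mem_body m
  · have hpos : interior T.body = {x | ∀ i, 0 < T.affineBasis.coord i x} :=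
      T.affineBasis.interior_convexHull
    rw [hpos, ← Finset.affineCombination_eq_linear_combination _ _ _ hweights] at hint
    exact (hint k).ne'
      (T.affineBasis.coord_apply_combination_of_notMem (Finset.notMem_erase k _) hweights)
  · exact mem_of_sum_smul_mem_of_isExtreme (convex_convexHull ℝ _) hF (fun _ _ => by norm_num)
      hweights (fun j _ => T.points_mem_body j) hx (Finset.mem_erase.2 ⟨hm, Finset.mem_univ m⟩)

variable {T} in
theorem exists_points_eq_of_isExtreme {S : Tetrahedron} {F : Set E3}
    (hT : IsExtreme ℝ T.body F) (hS : IsExtreme ℝ S.body F) {m : Fin 4} (hm : T.points m ∈ F) :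
    ∃ i : Fin 4, S.points i = T.points m := by
  have hext : T.points m ∈ F.extremePoints ℝ :=
    hT.extremePoints_eq ▸ ⟨hm, mem_extremePoints_convexHull_range T.independent m⟩
  have hvertex : T.points m ∈ range S.points :=
    extremePoints_convexHull_subset (hS.extremePoints_subset_extremePoints hext)
  exact hvertex

end Tetrahedron

namespace IsFaceToFaceTiling

variable {T : Tetrahedron} {𝒯 : Set (Set E3)}

theorem exists_neighbour (h : IsFaceToFaceTiling T 𝒯) {S : Tetrahedron} (hS : S.body ∈ 𝒯)
    (k : Fin 4) : ∃ L ∈ 𝒯, L ≠ S.body ∧ ∀ m ≠ k, S.points m ∈ S.body ∩ L := by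
  obtain ⟨x, hxS, hx, hfacet⟩ := S.exists_notMem_interior_body k
  obtain ⟨L, hL, hne, hxL⟩ := h.exists_ne_mem hx
  exact ⟨L, hL, hne, hfacet _ (h.face_to_face _ hS L hL).1.2 ⟨hxS, hxL⟩⟩

theorem exists_direct_neighbour (h : IsFaceToFaceTiling T 𝒯) (hdirect : IsOrientationPreserving 𝒯)
    (k : Fin 4) : ∃ χ : E3 ≃ᵃⁱ[ℝ] E3, IsDirectIsometry χ ∧ χ '' T.body ≠ T.body ∧
      ∀ m ≠ k, ∃ i : Fin 4, χ (T.points i) = T.points m := by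
  obtain ⟨K, hK, -⟩ : (0 : E3) ∈ ⋃₀ 𝒯 := h.cover ▸ mem_univ _
  obtain ⟨φ, rfl⟩ := h.congruent K hK
  rw [← T.body_image] at hK
  obtain ⟨L, hL, hne, hfacet⟩ := h.exists_neighbour hK k
  obtain ⟨ψ, hψ, hψL⟩ := hdirect _ hK L hL
  obtain rfl : (T.image (ψ * φ)).body = L := by
    rw [← hψL, T.body_image, T.body_image, mul_image]
  have hface := h.face_to_face _ hK _ hL
  refine ⟨φ⁻¹ * ψ * φ, ?_, fun hχ => hne ?_, fun m hm => ?_⟩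
  · simpa only [inv_inv] using hψ.conj φ⁻¹
  · rw [T.body_image, T.body_image, ← congrArg (φ '' ·) hχ, ← mul_image, mul_assoc φ⁻¹,
      mul_inv_cancel_left]
  · obtain ⟨i, hi⟩ :=
      Tetrahedron.exists_points_eq_of_isExtreme hface.1.2 hface.2.2 (hfacet m hm)
    refine ⟨i, ?_⟩
    change φ⁻¹ ((T.image (ψ * φ)).points i) = _
    rw [hi]
    exact φ.symm_apply_apply _

theorem not_isOrientationPreserving_of_rigid_facet (h : IsFaceToFaceTiling T 𝒯) (k : Fin 4)
    (hrigid : ∀ f : Fin 4 → Fin 4, (∀ m ≠ k, ∀ n ≠ k, T.len (f m) (f n) = T.len m n) →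
      ∃ ρ : E3 ≃ᵃⁱ[ℝ] E3, IsDirectIsometry ρ ∧ ρ '' T.body = T.body ∧
        ∀ m ≠ k, ρ (T.points m) = T.points (f m)) : ¬ IsOrientationPreserving 𝒯 := by
  intro hdirect
  obtain ⟨χ, hχ, hne, hvertex⟩ := h.exists_direct_neighbour hdirect k
  choose! f hf using hvertex
  obtain ⟨ρ, hρ, hρT, hρf⟩ := hrigid f fun m hm n hn => by
    rw [Tetrahedron.len, ← χ.dist_map, hf m hm, hf n hn, Tetrahedron.len]
  have : Nonempty {m // m ≠ k} := nonempty_subtype.2 (exists_ne k)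
  have hone : χ * ρ = 1 := eq_one_of_linearDet_pos_of_fixes (hχ.mul hρ)
    (T.independent.comp_embedding (.subtype (· ≠ k))) (by simp) fun m =>
      (congrArg χ (hρf m m.2)).trans (hf m m.2)
  exact hne (by rw [← hρT, ← mul_image, hone, one_image, hρT])

end IsFaceToFaceTiling

namespace Tetrahedron

variable {T : Tetrahedron} {a b c d : ℝ}

theorem len_pos {i j : Fin 4} (hij : i ≠ j) : 0 < T.len i j :=
  dist_pos.2 (T.independent.injective.ne hij)

theorem IsGoldbergFirst.len_eq (hT : T.IsGoldbergFirst a b c) (i j : Fin 4) :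
    T.len i j = ![![0, b, c, a], ![b, 0, b, c], ![c, b, 0, b], ![a, c, b, 0]] i j := by
  fin_cases i <;> fin_cases j <;>
    simp [len_self, hT.len12, hT.len13, hT.len14, hT.len23, hT.len24, hT.len34,
      len_comm (i := 1) (j := 0), len_comm (i := 2) (j := 0), len_comm (i := 2) (j := 1),
      len_comm (i := 3)]

theorem IsGoldbergSecond.len_eq (hT : T.IsGoldbergSecond a b c d) (i j : Fin 4) :
    T.len i j =
      ![![0, b, c, a / 2], ![b, 0, b, d], ![c, b, 0, d], ![a / 2, d, d, 0]] i j := by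
  fin_cases i <;> fin_cases j <;>
    simp [len_self, hT.len12, hT.len13, hT.len14, hT.len23, hT.len24, hT.len34,
      len_comm (i := 1) (j := 0), len_comm (i := 2) (j := 0), len_comm (i := 2) (j := 1),
      len_comm (i := 3)]

theorem IsGoldbergFirst.index_eq_or_rev_of_len_eq (hT : T.IsGoldbergFirst a b c) (hab : a ≠ b)
    (hac : a ≠ c) {i j l : Fin 4} (hil : T.len i l = a) (hij : T.len i j = b) :
    i = 0 ∧ j = 1 ∧ l = 3 ∨ i = 3 ∧ j = 2 ∧ l = 0 := by
  have ha : 0 < a := hT.len14 ▸ len_pos (by decide)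
  have hb : 0 < b := hT.len12 ▸ len_pos (by decide)
  have hbc : b ≠ c := fun h => (pow_pos ha 2).ne' (by linarith [hT.rel, congrArg (· ^ 2) h])
  rw [hT.len_eq] at hil hij
  have hends : i = 0 ∧ l = 3 ∨ i = 3 ∧ l = 0 := by
    clear hij
    fin_cases i <;> fin_cases l <;> simp_all [ha.ne, hab.symm, hac.symm]
  obtain ⟨rfl, rfl⟩ | ⟨rfl, rfl⟩ := hends <;> fin_cases j <;> simp_all [hb.ne, hbc.symm]

theorem IsGoldbergSecond.index_eq_of_len_eq (hT : T.IsGoldbergSecond a b c d) (had : a ≠ 2 * d)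
    {i j l : Fin 4} (hij : T.len i j = c) (hil : T.len i l = a / 2) (hjl : T.len j l = d) :
    i = 0 ∧ j = 2 ∧ l = 3 := by
  have ha : 0 < a / 2 := hT.len14 ▸ len_pos (by decide)
  have hb : 0 < b := hT.len12 ▸ len_pos (by decide)
  have hc : 0 < c := hT.len13 ▸ len_pos (by decide)
  have hd : 0 < d := hT.len24 ▸ len_pos (by decide)
  have hdb : d < b := lt_of_pow_lt_pow_left₀ 2 hb.le (by nlinarith [hT.rel₁])
  have hbc : b < c := lt_of_pow_lt_pow_left₀ 2 hc.le (by nlinarith [hT.rel₂])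
  have hac : a / 2 < c := lt_of_pow_lt_pow_left₀ 2 hc.le (by nlinarith [hT.rel₂])
  have had' : a / 2 ≠ d := fun h => had (by linarith)
  rw [hT.len_eq] at hij hil hjl
  have hends : i = 0 ∧ j = 2 ∨ i = 2 ∧ j = 0 := by
    clear hil hjl
    fin_cases i <;> fin_cases j <;> simp_all [hc.ne, hbc.ne, hac.ne, (hdb.trans hbc).ne]
  obtain ⟨rfl, rfl⟩ | ⟨rfl, rfl⟩ := hends <;> fin_cases l <;> simp_all [ha.ne, hd.ne]

theorem IsGoldbergFirst.not_isOrientationPreserving (hT : T.IsGoldbergFirst a b c) (hab : a ≠ b)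
    (hac : a ≠ c) {𝒯 : Set (Set E3)} (h𝒯 : IsFaceToFaceTiling T 𝒯) :
    ¬ IsOrientationPreserving 𝒯 := by
  obtain ⟨F, hF⟩ := hT.exists_frame
  refine h𝒯.not_isOrientationPreserving_of_rigid_facet 2 fun f hf => ?_
  have hil := (hf 0 (by decide) 3 (by decide)).trans hT.len14
  have hij := (hf 0 (by decide) 1 (by decide)).trans hT.len12
  obtain ⟨h₀, h₁, h₃⟩ | ⟨h₀, h₁, h₃⟩ :=
    hT.index_eq_or_rev_of_len_eq hab hac hil hij
  · refine ⟨1, .one, one_image _, fun m hm => ?_⟩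
    fin_cases m <;> simp_all
  · have hvertex (m : Fin 4) : F.halfTurn (T.points m) = T.points m.rev := by
      rw [← hF, F.halfTurn_vertex]
    refine ⟨F.halfTurn, F.isDirectIsometry_halfTurn, ?_, fun m hm => ?_⟩
    · rw [← body_image, body, body, ← Fin.rev_surjective.range_comp T.points]
      exact congrArg (fun p => convexHull ℝ (range p)) (funext hvertex)
    · rw [hvertex]
      fin_cases m <;> simp_all [Fin.rev]

theorem IsGoldbergSecond.not_isOrientationPreserving (hT : T.IsGoldbergSecond a b c d)
    (had : a ≠ 2 * d) {𝒯 : Set (Set E3)} (h𝒯 : IsFaceToFaceTiling T 𝒯) :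
    ¬ IsOrientationPreserving 𝒯 := by
  refine h𝒯.not_isOrientationPreserving_of_rigid_facet 1 fun f hf => ?_
  have hij := (hf 0 (by decide) 2 (by decide)).trans hT.len13
  have hil := (hf 0 (by decide) 3 (by decide)).trans hT.len14
  have hjl := (hf 2 (by decide) 3 (by decide)).trans hT.len34
  obtain ⟨h₀, h₂, h₃⟩ := hT.index_eq_of_len_eq had hij hil hjl
  refine ⟨1, .one, one_image _, fun m hm => ?_⟩
  fin_cases m <;> simp_all

end Tetrahedron

theorem proposition3p2 :
    -- both families have a member for all `a, b > 0` with `a < 3 b`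
    (∀ a b : ℝ, 0 < a → a < 3 * b →
      (∃ (c : ℝ) (T : Tetrahedron), T.IsGoldbergFirst a b c) ∧
      (∃ (c d : ℝ) (T : Tetrahedron), T.IsGoldbergSecond a b c d)) ∧
    -- first family
    (∀ (a b c : ℝ) (T : Tetrahedron), T.IsGoldbergFirst a b c →
      (∃ 𝒯 : Set (Set E3), IsFaceToFaceTiling T 𝒯 ∧ IsAlternatingPrismDissection 𝒯) ∧
      (a ≠ b → a ≠ c →
        ∀ 𝒯 : Set (Set E3), IsFaceToFaceTiling T 𝒯 → ¬ IsOrientationPreserving 𝒯)) ∧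
    -- second family
    (∀ (a b c d : ℝ) (T : Tetrahedron), T.IsGoldbergSecond a b c d →
      (∃ 𝒯 : Set (Set E3), IsFaceToFaceTiling T 𝒯 ∧ IsAlternatingPrismDissection 𝒯) ∧
      (a ≠ 2 * d →
        ∀ 𝒯 : Set (Set E3), IsFaceToFaceTiling T 𝒯 → ¬ IsOrientationPreserving 𝒯)) := by
  refine ⟨fun a b ha hab => ⟨?_, ?_⟩, fun a b c T hT => ⟨hT.exists_tiling, ?_⟩,
    fun a b c d T hT => ⟨hT.exists_tiling, ?_⟩⟩
  · exact Tetrahedron.exists_isGoldbergFirst ha hab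
  · exact Tetrahedron.exists_isGoldbergSecond ha hab
  · exact fun hab hac 𝒯 h𝒯 => hT.not_isOrientationPreserving hab hac h𝒯
  · exact fun had 𝒯 h𝒯 => hT.not_isOrientationPreserving had h𝒯
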